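/- Theorem. A (two-sided) *projection algebra* is a set $P$ with binary operations $\times,\star$ such that for all $e,f,g\in P$: (L1) $e\times e=e$; (L2) $(e\times f)\times e=e\times f$; (L3) $e\times(f\times g)=(e\times f)\times(f\times g)$; (L4) $(e\times f)\times g=(e\times f)\times(e\times g)$; (R1) $e\star e=e$; (R2) $f\star e=e\star(f\star e)$; (R3) $(g\star f)\star e=(g\star f)\star(f\star e)$; (R4) $g\star(f\star e)=(g\star e)\star(f\star e)$; (P3) $(e\star(f\times g))\star g=(e\star f)\star g$ and $g\times((g\star f)\times e)=g\times(f\times e)$; (P4) $(e\times f)\star e=e\times f$ and $f\times(e\star f)=e\star f$. It is *strong* if moreover $e\times(((e\times f)\times g)\star f)=(e\times f)\times g$ and $(f\times(g\star(f\star e)))\star e=g\star(f\star e)$. A *DRC-restriction semigroup* is a semigroup $S$ with unary operations ${}^+,{}^*$ satisfying $x^+x=x$, $(xy)^+=(xy^+)^+$, $(xy)^+=x^+(xy)^+x^+$, $x^{++}=x^+$, $x^{+*}=x^+$, the dual identities $xx^*=x$, $(xy)^*=(x^*y)^*$, $(xy)^*=y^*(xy)^*y^*$, $x^{**}=x^*$,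 $x^{*+}=x^*$, and $x(yx)^*=(yx^+)^*x$, $(xy)^+x=x(x^*y)^+$. Its projection algebra is $P(S)=\{x^+\mid x\in S\}$ with $e\times f=(ef)^+$, $e\star f=(ef)^*$ (a strong projection algebra), and $S$ is *projection-generated* if $P(S)$ generates $S$ as a semigroup. A (2,1,1)-homomorphism is a map preserving the product, ${}^+$ and ${}^*$. Let $P$ be a strong projection algebra. Write $e\le_P f$ if $e=f\times e$, and $p\,\mathcal F\,q$ if $p\times q=p$ and $p\star q=q$. The path category $\mathscr P(P)$ consists of the paths $\mathfrak p=(p_1,\dots,p_k)$, $k\ge1$, with $p_1\,\mathcal F\,p_2\,\mathcal F\cdots\mathcal F\,p_k$; put $\mathbf d(\mathfrak p)=p_1$, $\mathbf r(\mathfrak p)=p_k$, and $(p_1,\dots,p_k)\circ(q_1,\dots,q_l)=(p_1,\dots,p_k,q_2,\dots,q_l)$ when $p_k=q_1$. For $q\le_P p_1$ the left restriction of $\mathfrak p$ to $q$ is $(q_1,\dots,q_k)$ with $q_1=q$, $q_i=q_{i-1}\star p_i$, and $\mathfrak p\le\mathfrak q$ means that $\mathfrak p$ is a left restriction of $\mathfrak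 q$. Call $(e,p,f)\in P^3$ admissible if $f=(e\star p)\star f$ and $e=e\times(p\times f)$. Let $\approx_P$ be the congruence on $\mathscr P(P)$ generated by the pairs $((p,p),(p))$, $p\in P$, and $((e,e\star p,f),(e,p\times f,f))$, $(e,p,f)$ admissible. The chain category is $\mathscr C(P)=\mathscr P(P)/{\approx_P}$, with the induced $\mathbf d,\mathbf r\in P$ and $\circ$, ordered by: $a\le b$ if some path in $a$ is below some path in $b$. Write $[\mathfrak p]$ for the class of $\mathfrak p$, and $[p]=[(p)]$ for $p\in P$. For $q\le_P\mathbf d(a)$ (respectively $q\le_P\mathbf r(a)$) let ${}_q{\downharpoonleft}a$ (respectively $a{\downharpoonright}_q$) be the unique $u\le a$ in $\mathscr C(P)$ with $\mathbf d(u)=q$ (respectively $\mathbf r(u)=q$). The chain semigroup $\mathbf S(\mathscr C(P))$ is the set $\mathscr C(P)$ with $$a\bullet b=a{\downharpoonright}_{p}\circ[p,q]\circ{}_{q}{\downharpoonleft}b,\quad p=\mathbf r(a)\times\mathbf d(b),\ q=\mathbf r(a)\star\mathbf d(b),\qquad a^+=[\mathbf d(a)],\quad a^*=[\mathbf r(a)].$$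 Then: (1) $\mathbf S(\mathscr C(P))$ is a projection-generated DRC-restriction semigroup, its set of projections is $\{[p]\mid p\in P\}$, and $p\mapsto[p]$ is an isomorphism from $P$ onto the projection algebra of $\mathbf S(\mathscr C(P))$. (2) If $S$ is a projection-generated DRC-restriction semigroup and $\iota\colon P\to P(S)$ is an isomorphism of projection algebras (in particular, if $P=P(S)$ and $\iota=\mathrm{id}$), then there is a surjective (2,1,1)-homomorphism $\phi\colon\mathbf S(\mathscr C(P))\to S$ with $\phi([p])=\iota(p)$ for all $p\in P$. -/

import Mathlib

universe u v

/-! ## Strong projection algebras -/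

/-- A type with the two binary operations of a (two-sided) projection algebra. -/
class ProjOps (P : Type u) where
  times : P → P → P
  star : P → P → P

infixl:70 " ×ₚ " => ProjOps.times
infixl:70 " ⋆ₚ " => ProjOps.star

/-- Two-sided projection algebras. -/
class IsProjectionAlgebra (P : Type u) [ProjOps P] : Prop where
  L1 : ∀ e : P, e ×ₚ e = e
  L2 : ∀ e f : P, (e ×ₚ f) ×ₚ e = e ×ₚ f
  L3 : ∀ e f g : P, e ×ₚ (f ×ₚ g) = (e ×ₚ f) ×ₚ (f ×ₚ g)
  L4 : ∀ e f g : P, (e ×ₚ f) ×ₚ g = (e ×ₚ f) ×ₚ (e ×ₚ g)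
  R1 : ∀ e : P, e ⋆ₚ e = e
  R2 : ∀ e f : P, f ⋆ₚ e = e ⋆ₚ (f ⋆ₚ e)
  R3 : ∀ e f g : P, (g ⋆ₚ f) ⋆ₚ e = (g ⋆ₚ f) ⋆ₚ (f ⋆ₚ e)
  R4 : ∀ e f g : P, g ⋆ₚ (f ⋆ₚ e) = (g ⋆ₚ e) ⋆ₚ (f ⋆ₚ e)
  P3l : ∀ e f g : P, (e ⋆ₚ (f ×ₚ g)) ⋆ₚ g = (e ⋆ₚ f) ⋆ₚ g
  P3r : ∀ e f g : P, g ×ₚ ((g ⋆ₚ f) ×ₚ e) = g ×ₚ (f ×ₚ e)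
  P4l : ∀ e f : P, (e ×ₚ f) ⋆ₚ e = e ×ₚ f
  P4r : ∀ e f : P, f ×ₚ (e ⋆ₚ f) = e ⋆ₚ f

/-- Strong projection algebras. -/
class IsStrongProjectionAlgebra (P : Type u) [ProjOps P] : Prop
    extends IsProjectionAlgebra P where
  SP1 : ∀ e f g : P, e ×ₚ (((e ×ₚ f) ×ₚ g) ⋆ₚ f) = (e ×ₚ f) ×ₚ g
  SP2 : ∀ e f g : P, (f ×ₚ (g ⋆ₚ (f ⋆ₚ e))) ⋆ₚ e = g ⋆ₚ (f ⋆ₚ e)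

/-- An isomorphism of projection algebras. -/
structure ProjIso (P : Type u) (Q : Type v) [ProjOps P] [ProjOps Q] extends P ≃ Q where
  map_times : ∀ e f : P, toFun (e ×ₚ f) = toFun e ×ₚ toFun f
  map_star : ∀ e f : P, toFun (e ⋆ₚ f) = toFun e ⋆ₚ toFun f

namespace ProjOps

/-- The natural partial order `e ≤_P f` of a projection algebra. -/
def le {P : Type u} [ProjOps P] (e f : P) : Prop := e = f ×ₚ e

/-- The relation `p 𝓕_P q`. -/
def F {P : Type u} [ProjOps P] (p q : P) : Prop := p ×ₚ q = p ∧ p ⋆ₚ q = q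

/-- `(e, p, f)` is an admissible triple. -/
def Admissible {P : Type u} [ProjOps P] (e p f : P) : Prop :=
  f = (e ⋆ₚ p) ⋆ₚ f ∧ e = e ×ₚ (p ×ₚ f)

section Lemmas

open IsProjectionAlgebra IsStrongProjectionAlgebra

variable {P : Type u} [ProjOps P] [IsProjectionAlgebra P]

theorem times_le (e f : P) : le (e ×ₚ f) e := by
  have h := L4 e e f
  rwa [L1] at h

theorem star_le (e f : P) : le (e ⋆ₚ f) f := (P4r e f).symm

theorem le.times_eq {e f : P} (h : le e f) : e ×ₚ f = e := by
  have h' : e = f ×ₚ e := h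
  rw [h', L2]

theorem le.star_eq {e f : P} (h : le e f) : e ⋆ₚ f = e := by
  have h' : e = f ×ₚ e := h
  rw [h', P4l]

theorem le.star_eq' {e f : P} (h : le e f) : f ⋆ₚ e = e := by
  have h1 := h.star_eq
  have h2 : f ⋆ₚ (e ⋆ₚ f) = e ⋆ₚ f := (R2 f e).symm
  rwa [h1] at h2

theorem times_star (e f : P) : (e ×ₚ f) ⋆ₚ f = e ⋆ₚ f := by
  have h := P3l e e f
  rwa [R1, (times_le e f).star_eq'] at h

theorem star_times (e f : P) : e ×ₚ (e ⋆ₚ f) = e ×ₚ f := by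
  have h := P3r f f e
  rwa [L1, (star_le e f).times_eq] at h

theorem F_times_star (p q : P) : F (p ×ₚ q) (p ⋆ₚ q) := by
  have h1 : (p ×ₚ q) ×ₚ (p ⋆ₚ q) = p ×ₚ q := by
    rw [← times_star, star_times, L4, L1]
  have h2 : (p ×ₚ q) ⋆ₚ (p ⋆ₚ q) = p ⋆ₚ q := by
    rw [← star_times, times_star, R4, R1]
  exact ⟨h1, h2⟩

theorem star_mono {e f : P} (h : le e f) (g : P) : le (e ⋆ₚ g) (f ⋆ₚ g) := by
  have h1 : (e ⋆ₚ f) ⋆ₚ g = (e ⋆ₚ f) ⋆ₚ (f ⋆ₚ g) := R3 g f e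
  rw [h.star_eq] at h1
  rw [h1]
  exact star_le _ _

theorem times_mono {e f : P} (h : le e f) (g : P) : le (g ×ₚ e) (g ×ₚ f) := by
  have h1 : g ×ₚ (f ×ₚ e) = (g ×ₚ f) ×ₚ (f ×ₚ e) := L3 g f e
  have h2 : f ×ₚ e = e := h.symm
  rw [h2] at h1
  rw [h1]
  exact times_le _ _

variable {Q : Type u} [ProjOps Q] [IsStrongProjectionAlgebra Q]

theorem times_star_cancel {e f g : Q} (h : le g (e ×ₚ f)) : e ×ₚ (g ⋆ₚ f) = g := by
  have h1 : g = (e ×ₚ f) ×ₚ g := h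
  have h2 := SP1 e f g
  rwa [← h1] at h2

theorem star_times_cancel {e f g : Q} (h : le g (f ⋆ₚ e)) : (f ×ₚ g) ⋆ₚ e = g := by
  have h1 : g ⋆ₚ (f ⋆ₚ e) = g := h.star_eq
  have h2 := SP2 e f g
  rwa [h1] at h2

theorem star_times_eq (p s t : Q) : (p ⋆ₚ s) ×ₚ t = (p ×ₚ (s ×ₚ t)) ⋆ₚ s := by
  rw [← P3r, star_times_cancel (times_le _ _)]

theorem star_of_times (p s t : Q) : t ⋆ₚ (s ×ₚ p) = s ×ₚ ((t ⋆ₚ s) ⋆ₚ p) := by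
  rw [← P3l, times_star_cancel (star_le _ _)]

theorem F.left_restrict {p x q : Q} (h : F p x) (hq : le q p) : F q (q ⋆ₚ x) := by
  have h1 := F_times_star q x
  have h2 : p ×ₚ (q ⋆ₚ x) = q := times_star_cancel (by rw [h.1]; exact hq)
  have h3 : q ×ₚ x = q := by
    have h4 : (p ×ₚ q) ×ₚ x = (p ×ₚ q) ×ₚ (p ×ₚ x) := L4 p q x
    have h5 : p ×ₚ q = q := hq.symm
    rw [h5, h.1, hq.times_eq] at h4
    exact h4
  rwa [h3] at h1

theorem F.right_restrict {p x q : Q} (h : F p x) (hq : le q x) : F (p ×ₚ q) q := by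
  have h1 := F_times_star p q
  have h3 : p ⋆ₚ q = q := by
    have h4 : p ⋆ₚ (q ⋆ₚ x) = (p ⋆ₚ x) ⋆ₚ (q ⋆ₚ x) := R4 x q p
    rw [hq.star_eq, h.2, hq.star_eq'] at h4
    exact h4
  rwa [h3] at h1

theorem F.star_cancel {p x q : Q} (h : F p x) (hq : le q p) : p ×ₚ (q ⋆ₚ x) = q :=
  times_star_cancel (by rw [h.1]; exact hq)

theorem F.times_cancel {p x q : Q} (h : F p x) (hq : le q x) : (p ×ₚ q) ⋆ₚ x = q :=
  star_times_cancel (by rw [h.2]; exact hq)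

theorem Admissible.times_eq {e p f : Q} (h : Admissible e p f) : e ×ₚ p = e := by
  have h1 := times_mono (times_le p f) e
  rw [← h.2] at h1
  have h2 : e = (e ×ₚ p) ×ₚ e := h1
  rwa [L2, eq_comm] at h2

theorem Admissible.star_eq {e p f : Q} (h : Admissible e p f) : p ⋆ₚ f = f := by
  have h1 := star_mono (star_le e p) f
  rw [← h.1] at h1
  have h2 : f ⋆ₚ (p ⋆ₚ f) = f := h1.star_eq
  rwa [← R2] at h2

theorem Admissible.F₁ {e p f : Q} (h : Admissible e p f) : F e (e ⋆ₚ p) := by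
  have h1 := F_times_star e p
  rwa [h.times_eq] at h1

theorem Admissible.F₂ {e p f : Q} (h : Admissible e p f) : F (e ⋆ₚ p) f := by
  have h1 := F_times_star (e ⋆ₚ p) f
  rwa [star_times_eq, ← h.2, ← h.1] at h1

theorem Admissible.F₃ {e p f : Q} (h : Admissible e p f) : F e (p ×ₚ f) := by
  have h1 := F_times_star e (p ×ₚ f)
  rwa [star_of_times, ← h.1, ← h.2] at h1

theorem Admissible.F₄ {e p f : Q} (h : Admissible e p f) : F (p ×ₚ f) f := by
  have h1 := F_times_star p f
  rwa [h.star_eq] at h1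

theorem Admissible.restrict {e p f e' : Q} (h : Admissible e p f) (he : le e' e) :
    Admissible e' p ((e' ⋆ₚ p) ⋆ₚ f) := by
  refine ⟨by rw [R4, R1], ?_⟩
  have h1 := star_times e' (p ×ₚ f)
  rw [star_of_times] at h1
  rw [h1]
  exact (h.F₃.left_restrict he).1.symm.trans (star_times e' (p ×ₚ f))

end Lemmas

end ProjOps

/-! ## The path category -/

section Constructions

open ProjOps

/-- A `P`-path `(p₁, …, p_k)`, `k ≥ 1`, with `p₁ 𝓕 p₂ 𝓕 ⋯ 𝓕 p_k`. -/
@[ext]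
structure PPath (P : Type u) [ProjOps P] where
  toList : List P
  ne : toList ≠ []
  chain : toList.IsChain F

namespace PPath

section Basic

variable {P : Type u} [ProjOps P]

/-- The domain `p₁` of a path `(p₁, …, p_k)`. -/
def dom (a : PPath P) : P := a.toList.head a.ne

/-- The range `p_k` of a path `(p₁, …, p_k)`. -/
def ran (a : PPath P) : P := a.toList.getLast a.ne

/-- The path `(p)` of length one. -/
def single (p : P) : PPath P := ⟨[p], by simp, by simp⟩

/-- The path `(p, q)`, for `p 𝓕 q`. -/
def pair (p q : P) (h : F p q) : PPath P := ⟨[p, q], by simp, by simpa using h⟩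

/-- The path `(p, q, r)`, for `p 𝓕 q 𝓕 r`. -/
def triple (p q r : P) (h : F p q) (h' : F q r) : PPath P :=
  ⟨[p, q, r], by simp, by simpa using ⟨h, h'⟩⟩

theorem isChain_comp (a b : PPath P) (h : a.ran = b.dom) :
    (a.toList ++ b.toList.tail).IsChain F := by
  obtain ⟨l, hl, hc⟩ := a
  obtain ⟨m, hm, hd⟩ := b
  cases m with
  | nil => exact absurd rfl hm
  | cons x t =>
    simp only [ran, dom, List.head_cons] at h
    subst h
    obtain ⟨l', y, rfl⟩ := List.eq_nil_or_concat l |>.resolve_left hl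
    rw [List.concat_eq_append] at hc
    simp only [List.concat_eq_append, List.tail_cons, List.append_assoc, List.getLast_append_singleton,
      List.singleton_append] at hd ⊢
    exact List.isChain_split.2 ⟨hc, hd⟩

/-- The composition `(p₁, …, p_k = q₁, q₂, …, q_l)` of the paths `(p₁, …, p_k)` and
`(q₁, …, q_l)`, defined when `p_k = q₁`. -/
def comp (a b : PPath P) (h : a.ran = b.dom) : PPath P :=
  ⟨a.toList ++ b.toList.tail, by simp [a.ne], isChain_comp a b h⟩

theorem dom_comp (a b : PPath P) (h : a.ran = b.dom) : (a.comp b h).dom = a.dom := by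
  simp only [dom, comp]
  exact List.head_append_of_ne_nil a.ne

theorem ran_comp (a b : PPath P) (h : a.ran = b.dom) : (a.comp b h).ran = b.ran := by
  obtain ⟨m, hm, hd⟩ := b
  simp only [ran, dom, comp] at h ⊢
  match m with
  | [] => exact absurd rfl hm
  | [x] => simpa using h
  | x :: y :: t => simp

theorem scanl_head (q : P) (t : List P) :
    ∃ s, t.scanl (· ⋆ₚ ·) q = q :: s := by
  cases t <;> simp

end Basic

section Restriction

variable {P : Type u} [ProjOps P] [IsStrongProjectionAlgebra P]

theorem isChain_scanl (t : List P) (p q : P) (hc : (p :: t).IsChain F) (hq : le q p) :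
    (t.scanl (· ⋆ₚ ·) q).IsChain F := by
  induction t generalizing p q with
  | nil => simp
  | cons x t ih =>
    rw [List.isChain_cons_cons] at hc
    have h1 := ih x (q ⋆ₚ x) hc.2 (star_le _ _)
    obtain ⟨s, hs⟩ := scanl_head (q ⋆ₚ x) t
    rw [List.scanl_cons, hs, List.isChain_cons_cons]
    rw [hs] at h1
    exact ⟨hc.1.left_restrict hq, h1⟩

/-- The left restriction `(q, q ⋆ p₂, (q ⋆ p₂) ⋆ p₃, …)` of `(p₁, …, p_k)` to `q ≤ p₁`. -/
def leftRes (q : P) (a : PPath P) (h : le q a.dom) : PPath P :=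
  ⟨a.toList.tail.scanl (· ⋆ₚ ·) q, by simp,
    isChain_scanl _ a.dom q (by simpa [dom] using a.chain) h⟩

theorem scanr_spec (t : List P) (p q : P) (hc : (p :: t).IsChain F)
    (hq : le q ((p :: t).getLast (by simp))) :
    ((p :: t).dropLast.scanr (· ×ₚ ·) q).IsChain F ∧
      le ((p :: t).dropLast.foldr (· ×ₚ ·) q) p ∧
      t.scanl (· ⋆ₚ ·) ((p :: t).dropLast.foldr (· ×ₚ ·) q) =
        (p :: t).dropLast.scanr (· ×ₚ ·) q := by
  induction t generalizing p with
  | nil => simpa using hq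
  | cons x t ih =>
    rw [List.isChain_cons_cons] at hc
    obtain ⟨h1, h2, h3⟩ := ih x hc.2 (by simpa using hq)
    have h4 : (p :: x :: t).dropLast = p :: (x :: t).dropLast := rfl
    rw [h4, List.scanr_cons, List.foldr_cons, List.scanl_cons, hc.1.times_cancel h2]
    refine ⟨?_, times_le _ _, by rw [h3]⟩
    obtain ⟨s, hs⟩ := scanl_head ((x :: t).dropLast.foldr (· ×ₚ ·) q) t
    rw [← h3, hs, List.isChain_cons_cons]
    rw [← h3, hs] at h1
    exact ⟨hc.1.right_restrict h2, h1⟩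

theorem scanr_scanl (t : List P) (p q : P) (hc : (p :: t).IsChain F) (hq : le q p) :
    (p :: t).dropLast.scanr (· ×ₚ ·) (t.foldl (· ⋆ₚ ·) q) = t.scanl (· ⋆ₚ ·) q ∧
      (p :: t).dropLast.foldr (· ×ₚ ·) (t.foldl (· ⋆ₚ ·) q) = q := by
  induction t generalizing p q with
  | nil => simp
  | cons x t ih =>
    rw [List.isChain_cons_cons] at hc
    obtain ⟨h1, h2⟩ := ih x (q ⋆ₚ x) hc.2 (star_le _ _)
    have h4 : (p :: x :: t).dropLast = p :: (x :: t).dropLast := rfl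
    rw [h4, List.scanr_cons, List.foldr_cons, List.scanl_cons, List.foldl_cons, h1, h2,
      hc.1.star_cancel hq]
    exact ⟨rfl, rfl⟩

/-- The right restriction `(…, p_{k-2} × (p_{k-1} × q), p_{k-1} × q, q)` of `(p₁, …, p_k)` to
`q ≤ p_k`. -/
def rightRes (a : PPath P) (q : P) (h : le q a.ran) : PPath P :=
  ⟨a.toList.dropLast.scanr (· ×ₚ ·) q, by simp, by
    obtain ⟨l, hl, hc⟩ := a
    cases l with
    | nil => exact absurd rfl hl
    | cons p t => exact (scanr_spec t p q hc h).1⟩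

@[simp] theorem dom_leftRes (q : P) (a : PPath P) (h : le q a.dom) : (leftRes q a h).dom = q := by
  simp [dom, leftRes]

theorem ran_leftRes (q : P) (a : PPath P) (h : le q a.dom) :
    (leftRes q a h).ran = a.toList.tail.foldl (· ⋆ₚ ·) q :=
  List.getLast_scanl _

@[simp] theorem ran_rightRes (a : PPath P) (q : P) (h : le q a.ran) :
    (rightRes a q h).ran = q := by
  simp [ran, rightRes, List.getLast_scanr]

theorem dom_rightRes_le (a : PPath P) (q : P) (h : le q a.ran) : le (rightRes a q h).dom a.dom := by
  obtain ⟨l, hl, hc⟩ := a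
  cases l with
  | nil => exact absurd rfl hl
  | cons p t =>
    have := (scanr_spec t p q hc h).2.1
    simpa [dom, rightRes] using this

theorem foldl_le (t : List P) (p q : P) (h : le q p) :
    le (t.foldl (· ⋆ₚ ·) q) ((p :: t).getLast (by simp)) := by
  induction t generalizing p q with
  | nil => exact h
  | cons x t ih => simpa using ih x (q ⋆ₚ x) (star_le _ _)

theorem ran_leftRes_le (q : P) (a : PPath P) (h : le q a.dom) : le (leftRes q a h).ran a.ran := by
  rw [ran_leftRes]
  obtain ⟨l, hl, hc⟩ := a
  cases l with
  | nil => exact absurd rfl hl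
  | cons p t => exact foldl_le t p q h

theorem leftRes_eq_rightRes (q : P) (a : PPath P) (h : le q a.dom) :
    leftRes q a h = rightRes a (leftRes q a h).ran (ran_leftRes_le q a h) := by
  obtain ⟨l, hl, hc⟩ := a
  cases l with
  | nil => exact absurd rfl hl
  | cons p t =>
    have := (scanr_scanl t p q hc h).1
    ext1
    simp only [rightRes, ran_leftRes]
    exact this.symm

theorem rightRes_eq_leftRes (a : PPath P) (q : P) (h : le q a.ran) :
    rightRes a q h = leftRes (rightRes a q h).dom a (dom_rightRes_le a q h) := by
  obtain ⟨l, hl, hc⟩ := a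
  cases l with
  | nil => exact absurd rfl hl
  | cons p t =>
    have := (scanr_spec t p q hc h).2.2
    ext1
    simpa [leftRes, dom, rightRes] using this.symm

theorem leftRes_comp (q : P) (a b : PPath P) (h : a.ran = b.dom) (hq : le q (a.comp b h).dom) :
    leftRes q (a.comp b h) hq =
      (leftRes q a (by rwa [dom_comp] at hq)).comp
        (leftRes (leftRes q a (by rwa [dom_comp] at hq)).ran b (h ▸ ran_leftRes_le _ _ _))
        (dom_leftRes _ _ _).symm := by
  ext1
  obtain ⟨l, hl, hc⟩ := a
  cases l with
  | nil => exact absurd rfl hl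
  | cons p t => simp [leftRes, comp, ran, List.getLast_scanl, List.scanl_append]

/-- The natural order of the path category: `a` is a left restriction of `b`. -/
def ple (a b : PPath P) : Prop :=
  ∃ (r : P) (h : le r b.dom), a = leftRes r b h

end Restriction

end PPath

/-! ## The chain category -/

/-- The congruence `≈_P` on the path category generated by the pairs `((p, p), p)` and
`((e, e ⋆ p, f), (e, p × f, f))` for admissible triples `(e, p, f)`: the least equivalence relation
that contains these pairs and is compatible with composition on both sides. -/
inductive ChainRel {P : Type u} [ProjOps P] [IsStrongProjectionAlgebra P] :
    PPath P → PPath P → Prop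
  | idem (p : P) (h : F p p) : ChainRel (PPath.pair p p h) (PPath.single p)
  | adm (e p f : P) (h : Admissible e p f) :
      ChainRel (PPath.triple e (e ⋆ₚ p) f h.F₁ h.F₂) (PPath.triple e (p ×ₚ f) f h.F₃ h.F₄)
  | refl (a : PPath P) : ChainRel a a
  | symm {a b : PPath P} : ChainRel a b → ChainRel b a
  | trans {a b c : PPath P} : ChainRel a b → ChainRel b c → ChainRel a c
  | comp_left {a b : PPath P} (u : PPath P) (ha : u.ran = a.dom) (hb : u.ran = b.dom) :
      ChainRel a b → ChainRel (u.comp a ha) (u.comp b hb)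
  | comp_right {a b : PPath P} (v : PPath P) (ha : a.ran = v.dom) (hb : b.ran = v.dom) :
      ChainRel a b → ChainRel (a.comp v ha) (b.comp v hb)

namespace ChainRel

variable {P : Type u} [ProjOps P] [IsStrongProjectionAlgebra P]

theorem dom_ran {a b : PPath P} (h : ChainRel a b) : a.dom = b.dom ∧ a.ran = b.ran := by
  induction h with
  | idem p h => exact ⟨rfl, rfl⟩
  | adm e p f h => exact ⟨rfl, rfl⟩
  | refl a => exact ⟨rfl, rfl⟩
  | symm _ ih => exact ⟨ih.1.symm, ih.2.symm⟩
  | trans _ _ ih ih' => exact ⟨ih.1.trans ih'.1, ih.2.trans ih'.2⟩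
  | comp_left u ha hb _ ih => simp only [PPath.dom_comp, PPath.ran_comp, ih.2, and_self]
  | comp_right v ha hb _ ih => simp only [PPath.dom_comp, PPath.ran_comp, ih.1, and_self]

theorem leftRes {a b : PPath P} (h : ChainRel a b) (q : P) (ha : le q a.dom) (hb : le q b.dom) :
    ChainRel (PPath.leftRes q a ha) (PPath.leftRes q b hb) := by
  induction h generalizing q with
  | idem p h =>
    have h1 : q ⋆ₚ p = q := le.star_eq (f := p) ha
    have e1 : PPath.leftRes q (PPath.pair p p h) ha =
        PPath.pair q q ⟨IsProjectionAlgebra.L1 q, IsProjectionAlgebra.R1 q⟩ := by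
      ext1; simp [PPath.leftRes, PPath.pair, h1]
    have e2 : PPath.leftRes q (PPath.single p) hb = PPath.single q := by
      ext1; simp [PPath.leftRes, PPath.single]
    rw [e1, e2]
    exact idem _ _
  | adm e p f h =>
    have hq : le q e := ha
    have h' := h.restrict hq
    have k1 : q ⋆ₚ (e ⋆ₚ p) = q ⋆ₚ p := by
      rw [IsProjectionAlgebra.R4, (star_mono hq p).star_eq]
    have k2 : q ⋆ₚ (p ×ₚ f) = p ×ₚ ((q ⋆ₚ p) ⋆ₚ f) := star_of_times _ _ _
    have k3 : (q ⋆ₚ (p ×ₚ f)) ⋆ₚ f = (q ⋆ₚ p) ⋆ₚ f := IsProjectionAlgebra.P3l _ _ _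
    have e1 : PPath.leftRes q (PPath.triple e (e ⋆ₚ p) f h.F₁ h.F₂) ha =
        PPath.triple q (q ⋆ₚ p) ((q ⋆ₚ p) ⋆ₚ f) h'.F₁ h'.F₂ := by
      ext1; simp [PPath.leftRes, PPath.triple, k1]
    have e2 : PPath.leftRes q (PPath.triple e (p ×ₚ f) f h.F₃ h.F₄) hb =
        PPath.triple q (p ×ₚ ((q ⋆ₚ p) ⋆ₚ f)) ((q ⋆ₚ p) ⋆ₚ f) h'.F₃ h'.F₄ := by
      ext1
      simp only [PPath.leftRes, PPath.triple, List.tail_cons, List.scanl_cons, List.scanl_nil, k3]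
      rw [k2]
    rw [e1, e2]
    exact adm _ _ _ h'
  | refl a => exact refl _
  | symm _ ih => exact (ih q hb ha).symm
  | trans h1 _ ih ih' =>
    have hc := ha
    rw [h1.dom_ran.1] at hc
    exact (ih q ha hc).trans (ih' q hc hb)
  | comp_left u h1 h2 h3 ih =>
    rw [PPath.leftRes_comp, PPath.leftRes_comp]
    exact comp_left _ _ _ (ih _ _ _)
  | comp_right v h1 h2 h3 ih =>
    rw [PPath.leftRes_comp, PPath.leftRes_comp]
    have hqa := ha
    have hqb := hb
    rw [PPath.dom_comp] at hqa hqb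
    have key : ∀ (x y : PPath P) (s t : P) (hs : le s v.dom) (ht : le t v.dom)
        (hx : x.ran = (PPath.leftRes s v hs).dom) (hy : y.ran = (PPath.leftRes t v ht).dom),
        s = t → ChainRel x y →
          ChainRel (x.comp (PPath.leftRes s v hs) hx) (y.comp (PPath.leftRes t v ht) hy) := by
      intro x y s t hs ht hx hy hst hxy
      subst hst
      exact comp_right _ _ _ hxy
    have h4 := ih q hqa hqb
    exact key _ _ _ _ _ _ _ _ h4.dom_ran.2 h4

theorem rightRes {a b : PPath P} (h : ChainRel a b) (q : P) (ha : le q a.ran) (hb : le q b.ran) :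
    ChainRel (PPath.rightRes a q ha) (PPath.rightRes b q hb) := by
  have hd := PPath.dom_rightRes_le a q ha
  have hd' := hd
  rw [h.dom_ran.1] at hd'
  have h1 := h.leftRes _ hd hd'
  have h2 := h1.dom_ran.2
  rw [← PPath.rightRes_eq_leftRes, PPath.ran_rightRes] at h2
  have h3 := PPath.leftRes_eq_rightRes _ b hd'
  rw [PPath.rightRes_eq_leftRes a]
  rw [h3] at h1
  convert h1

end ChainRel

/-- `≈_P` as a setoid. -/
def chainSetoid (P : Type u) [ProjOps P] [IsStrongProjectionAlgebra P] : Setoid (PPath P) :=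
  ⟨ChainRel, ChainRel.refl, ChainRel.symm, ChainRel.trans⟩

/-- The chain category `𝒞(P) = 𝒫(P)/≈_P` (its set of arrows). -/
def ChainCategory (P : Type u) [ProjOps P] [IsStrongProjectionAlgebra P] : Type u :=
  Quotient (chainSetoid P)

namespace ChainCategory

variable {P : Type u} [ProjOps P] [IsStrongProjectionAlgebra P]

/-- The class `[a]` of a path `a`. -/
def mk (a : PPath P) : ChainCategory P := Quotient.mk (chainSetoid P) a

/-- The object `[p]` of the chain category, for `p ∈ P`. -/
def obj (p : P) : ChainCategory P := mk (PPath.single p)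

theorem mk_eq_mk {a b : PPath P} : mk a = mk b ↔ ChainRel a b :=
  ⟨fun h => Quotient.exact h, fun h => Quotient.sound h⟩

theorem exists_rep (a : ChainCategory P) : ∃ x : PPath P, mk x = a := Quotient.exists_rep a

/-- The domain of an arrow of the chain category, as an element of `P` (which is identified
with the set of objects through `p ↦ [p]`). -/
def dom (a : ChainCategory P) : P :=
  Quotient.lift PPath.dom (fun _ _ h => (ChainRel.dom_ran h).1) a

/-- The range of an arrow of the chain category, as an element of `P`. -/
def ran (a : ChainCategory P) : P :=
  Quotient.lift PPath.ran (fun _ _ h => (ChainRel.dom_ran h).2) a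

@[simp] theorem dom_mk (x : PPath P) : (mk x).dom = x.dom := rfl
@[simp] theorem ran_mk (x : PPath P) : (mk x).ran = x.ran := rfl

/-- Composition of the chain category: `[x] ∘ [y] = [x ∘ y]` when `ran x = dom y`. -/
def comp (a b : ChainCategory P) (h : a.ran = b.dom) : ChainCategory P :=
  Quotient.pliftOn a (fun x hx => Quotient.pliftOn b
      (fun y hy => mk (x.comp y (by subst hx hy; exact h)))
      (fun y y' hy hy' r => mk_eq_mk.2 (ChainRel.comp_left x _ _ r)))
    (fun x x' hx hx' r => by
      obtain ⟨y, rfl⟩ := exists_rep b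
      exact mk_eq_mk.2 (ChainRel.comp_right y _ _ r))

theorem comp_mk (x y : PPath P) (h : (mk x).ran = (mk y).dom) :
    comp (mk x) (mk y) h = mk (x.comp y h) := rfl

/-- The order of the chain category: `a ≤ b` if some path in `a` is below some path in `b`. -/
def cle (a b : ChainCategory P) : Prop :=
  ∃ x y : PPath P, mk x = a ∧ mk y = b ∧ x.ple y

theorem existsUnique_left (q : P) (x : PPath P) (h : le q x.dom) :
    ∃! u : ChainCategory P, cle u (mk x) ∧ u.dom = q := by
  refine ⟨mk (PPath.leftRes q x h), ⟨⟨_, x, rfl, rfl, q, h, rfl⟩, PPath.dom_leftRes q x h⟩, ?_⟩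
  rintro u ⟨⟨y, z, rfl, hz, r, hr, rfl⟩, hd⟩
  rw [dom_mk, PPath.dom_leftRes] at hd
  subst hd
  exact mk_eq_mk.2 ((mk_eq_mk.1 hz).leftRes _ _ _)

theorem existsUnique_right (x : PPath P) (q : P) (h : le q x.ran) :
    ∃! u : ChainCategory P, cle u (mk x) ∧ u.ran = q := by
  refine ⟨mk (PPath.rightRes x q h), ⟨⟨_, x, rfl, rfl, _, _, PPath.rightRes_eq_leftRes x q h⟩,
    PPath.ran_rightRes x q h⟩, ?_⟩
  rintro u ⟨⟨y, z, rfl, hz, r, hr, rfl⟩, hd⟩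
  rw [ran_mk] at hd
  subst hd
  exact (congrArg mk (PPath.leftRes_eq_rightRes r z hr)).trans
    (mk_eq_mk.2 ((mk_eq_mk.1 hz).rightRes _ _ _))

/-- The left restriction of `a` to `q ≤ dom a`: the unique `u ≤ a` with `dom u = q`. -/
noncomputable def leftRes (q : P) (a : ChainCategory P) (h : le q a.dom) : ChainCategory P :=
  (show ∃! u : ChainCategory P, cle u a ∧ u.dom = q by
    obtain ⟨x, rfl⟩ := exists_rep a
    exact existsUnique_left q x h).choose

/-- The right restriction of `a` to `q ≤ ran a`: the unique `u ≤ a` with `ran u = q`. -/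
noncomputable def rightRes (a : ChainCategory P) (q : P) (h : le q a.ran) : ChainCategory P :=
  (show ∃! u : ChainCategory P, cle u a ∧ u.ran = q by
    obtain ⟨x, rfl⟩ := exists_rep a
    exact existsUnique_right x q h).choose

theorem leftRes_mk (q : P) (x : PPath P) (h : le q (mk x).dom) :
    leftRes q (mk x) h = mk (PPath.leftRes q x h) :=
  (existsUnique_left q x h).unique (existsUnique_left q x h).choose_spec.1
    ⟨⟨_, x, rfl, rfl, q, h, rfl⟩, PPath.dom_leftRes q x h⟩

theorem rightRes_mk (x : PPath P) (q : P) (h : le q (mk x).ran) :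
    rightRes (mk x) q h = mk (PPath.rightRes x q h) :=
  (existsUnique_right x q h).unique (existsUnique_right x q h).choose_spec.1
    ⟨⟨_, x, rfl, rfl, _, _, PPath.rightRes_eq_leftRes x q h⟩, PPath.ran_rightRes x q h⟩

theorem dom_leftRes (q : P) (a : ChainCategory P) (h : le q a.dom) : (leftRes q a h).dom = q := by
  obtain ⟨x, rfl⟩ := exists_rep a
  rw [leftRes_mk]
  exact PPath.dom_leftRes q x h

theorem ran_rightRes (a : ChainCategory P) (q : P) (h : le q a.ran) :
    (rightRes a q h).ran = q := by
  obtain ⟨x, rfl⟩ := exists_rep a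
  rw [rightRes_mk]
  exact PPath.ran_rightRes x q h

theorem ran_comp (a b : ChainCategory P) (h : a.ran = b.dom) : (comp a b h).ran = b.ran := by
  obtain ⟨x, rfl⟩ := exists_rep a
  obtain ⟨y, rfl⟩ := exists_rep b
  exact PPath.ran_comp x y h

/-- The evaluation map `ε_P` on `(p, q)`, for `p 𝓕 q`: the class `[p, q]`. -/
def eval (p q : P) (h : F p q) : ChainCategory P := mk (PPath.pair p q h)

/-- The product of the chain semigroup: with `p = ran a × dom b` and `q = ran a ⋆ dom b`, it is the
composition of the right restriction of `a` to `p`, of `ε_P (p, q)`, and of the left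
restriction of `b` to `q`. -/
noncomputable def bullet (a b : ChainCategory P) : ChainCategory P :=
  comp
    (comp (rightRes a (a.ran ×ₚ b.dom) (times_le _ _))
      (eval (a.ran ×ₚ b.dom) (a.ran ⋆ₚ b.dom) (F_times_star _ _)) (ran_rightRes _ _ _))
    (leftRes (a.ran ⋆ₚ b.dom) b (star_le _ _))
    ((ran_comp _ _ _).trans (dom_leftRes _ _ _).symm)

end ChainCategory

end Constructions

/-! ## DRC-restriction semigroups -/

/-- A set with one binary operation and the two unary operations `x ↦ x⁺`, `x ↦ x^*`. -/
class BiUnary (S : Type u) extends Mul S where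
  plus : S → S
  ast : S → S

section DRC

open BiUnary

/-- DRC semigroups. -/
class IsDRCSemigroup (S : Type u) [BiUnary S] : Prop where
  mul_assoc : ∀ x y z : S, (x * y) * z = x * (y * z)
  i : ∀ x : S, plus x * x = x
  i' : ∀ x : S, x * ast x = x
  ii : ∀ x y : S, plus (x * y) = plus (x * plus y)
  ii' : ∀ x y : S, ast (x * y) = ast (ast x * y)
  iii : ∀ x y : S, plus (x * y) = plus x * plus (x * y) * plus x
  iii' : ∀ x y : S, ast (x * y) = ast y * ast (x * y) * ast y
  iv : ∀ x : S, plus (plus x) = plus x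
  iv' : ∀ x : S, ast (ast x) = ast x
  v : ∀ x : S, ast (plus x) = plus x
  v' : ∀ x : S, plus (ast x) = ast x

/-- DRC-restriction semigroups. -/
class IsDRCRestrictionSemigroup (S : Type u) [BiUnary S] : Prop extends IsDRCSemigroup S where
  vi : ∀ x y : S, x * ast (y * x) = ast (y * plus x) * x
  vi' : ∀ x y : S, plus (x * y) * x = x * plus (ast x * y)

/-- The set of projections `P(S) = {x⁺ | x ∈ S}`. -/
def projections (S : Type u) [BiUnary S] : Set S := Set.range (plus : S → S)

/-- `S` is projection-generated: the subsemigroup generated by `P(S)` is `S`. -/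
def IsProjectionGenerated (S : Type u) [BiUnary S] : Prop :=
  Subsemigroup.closure (projections S) = ⊤

/-- A (2,1,1)-homomorphism. -/
structure IsBiUnaryHom {S : Type u} {T : Type v} [BiUnary S] [BiUnary T] (φ : S → T) : Prop where
  map_mul : ∀ x y : S, φ (x * y) = φ x * φ y
  map_plus : ∀ x : S, φ (plus x) = plus (φ x)
  map_ast : ∀ x : S, φ (ast x) = ast (φ x)

/-- The projection algebra operations on `P(S)` of a DRC semigroup: `e × f = (ef)⁺` and
`e ⋆ f = (ef)^*`. -/
instance (S : Type u) [BiUnary S] [IsDRCSemigroup S] : ProjOps (projections S) where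
  times e f := ⟨plus (e.1 * f.1), Set.mem_range_self _⟩
  star e f := ⟨ast (e.1 * f.1), ⟨ast (e.1 * f.1), IsDRCSemigroup.v' _⟩⟩

namespace IsDRCSemigroup

variable {S : Type u} [BiUnary S] [IsDRCSemigroup S]

theorem plus_proj (e : projections S) : plus e.1 = e.1 := by
  obtain ⟨_, x, rfl⟩ := e
  exact iv x

theorem ast_proj (e : projections S) : ast e.1 = e.1 := by
  obtain ⟨_, x, rfl⟩ := e
  exact v x

theorem mul_self_proj (e : projections S) : e.1 * e.1 = e.1 := by
  have h := i e.1
  rwa [plus_proj] at h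

theorem proj_mul_plus (e : projections S) (x : S) : e.1 * plus (e.1 * x) = plus (e.1 * x) := by
  have h := iii e.1 x
  rw [plus_proj] at h
  rw [h, ← mul_assoc, ← mul_assoc, mul_self_proj]

theorem plus_mul_proj (e : projections S) (x : S) : plus (e.1 * x) * e.1 = plus (e.1 * x) := by
  have h := iii e.1 x
  rw [plus_proj] at h
  rw [h, mul_assoc, mul_self_proj]

theorem proj_mul_ast (e : projections S) (x : S) : e.1 * ast (x * e.1) = ast (x * e.1) := by
  have h := iii' x e.1
  rw [ast_proj] at h
  rw [h, ← mul_assoc, ← mul_assoc, mul_self_proj]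

theorem ast_mul_proj (e : projections S) (x : S) : ast (x * e.1) * e.1 = ast (x * e.1) := by
  have h := iii' x e.1
  rw [ast_proj] at h
  rw [h, mul_assoc, mul_self_proj]

theorem plus_mul_right (e f : projections S) : plus (e.1 * f.1) * f.1 = e.1 * f.1 := by
  rw [← plus_mul_proj e f.1, mul_assoc, i]

theorem mul_ast_left (e f : projections S) : e.1 * ast (e.1 * f.1) = e.1 * f.1 := by
  rw [← proj_mul_ast f e.1, ← mul_assoc, i']

/-- The projections of a DRC semigroup form a projection algebra. -/
instance : IsProjectionAlgebra (projections S) where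
  L1 e := Subtype.ext (by
    show plus (e.1 * e.1) = e.1
    rw [mul_self_proj, plus_proj])
  L2 e f := Subtype.ext (by
    show plus (plus (e.1 * f.1) * e.1) = plus (e.1 * f.1)
    rw [plus_mul_proj, iv])
  L3 e f g := Subtype.ext (by
    show plus (e.1 * plus (f.1 * g.1)) = plus (plus (e.1 * f.1) * plus (f.1 * g.1))
    rw [← ii, ← ii, ← mul_assoc (plus _), plus_mul_right, mul_assoc])
  L4 e f g := Subtype.ext (by
    show plus (plus (e.1 * f.1) * g.1) = plus (plus (e.1 * f.1) * plus (e.1 * g.1))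
    rw [← ii, ← mul_assoc, plus_mul_proj])
  R1 e := Subtype.ext (by
    show ast (e.1 * e.1) = e.1
    rw [mul_self_proj, ast_proj])
  R2 e f := Subtype.ext (by
    show ast (f.1 * e.1) = ast (e.1 * ast (f.1 * e.1))
    rw [proj_mul_ast, iv'])
  R3 e f g := Subtype.ext (by
    show ast (ast (g.1 * f.1) * e.1) = ast (ast (g.1 * f.1) * ast (f.1 * e.1))
    rw [← ii', ← ii', mul_assoc g.1 f.1 (ast _), mul_ast_left, mul_assoc])
  R4 e f g := Subtype.ext (by
    show ast (g.1 * ast (f.1 * e.1)) = ast (ast (g.1 * e.1) * ast (f.1 * e.1))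
    rw [← ii', mul_assoc, proj_mul_ast])
  P3l e f g := Subtype.ext (by
    show ast (ast (e.1 * plus (f.1 * g.1)) * g.1) = ast (ast (e.1 * f.1) * g.1)
    rw [← ii', ← ii', mul_assoc, plus_mul_right, mul_assoc])
  P3r e f g := Subtype.ext (by
    show plus (g.1 * plus (ast (g.1 * f.1) * e.1)) = plus (g.1 * plus (f.1 * e.1))
    rw [← ii, ← ii, ← mul_assoc, mul_ast_left, mul_assoc])
  P4l e f := Subtype.ext (by
    show ast (plus (e.1 * f.1) * e.1) = plus (e.1 * f.1)
    rw [plus_mul_proj, v])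
  P4r e f := Subtype.ext (by
    show plus (f.1 * ast (e.1 * f.1)) = ast (e.1 * f.1)
    rw [proj_mul_ast, v'])

end IsDRCSemigroup

open IsDRCSemigroup in
/-- The projection algebra of a DRC-restriction semigroup is strong. -/
instance (S : Type u) [BiUnary S] [IsDRCRestrictionSemigroup S] :
    IsStrongProjectionAlgebra (projections S) where
  SP1 e f g := Subtype.ext (by
    let k : projections S := ⟨plus (e.1 * f.1), Set.mem_range_self _⟩
    let h : projections S := ⟨plus (k.1 * g.1), Set.mem_range_self _⟩
    show plus (e.1 * ast (h.1 * f.1)) = h.1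
    have hk : h.1 * k.1 = h.1 := plus_mul_proj k g.1
    have he : h.1 * e.1 = h.1 := by
      rw [← hk, IsDRCSemigroup.mul_assoc, show k.1 * e.1 = k.1 from plus_mul_proj e f.1]
    have hef : h.1 * (e.1 * f.1) = h.1 * f.1 := by
      rw [← IsDRCSemigroup.mul_assoc, he]
    have h1 := IsDRCRestrictionSemigroup.vi (e.1 * f.1) h.1
    rw [hef, show h.1 * plus (e.1 * f.1) = h.1 from hk, ast_proj, hef, IsDRCSemigroup.mul_assoc,
      proj_mul_ast] at h1
    rw [h1]
    have h2 := ii h.1 (e.1 * f.1)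
    rwa [hef, show h.1 * plus (e.1 * f.1) = h.1 from hk, plus_proj] at h2)
  SP2 e f g := Subtype.ext (by
    let k : projections S := ⟨ast (f.1 * e.1), ⟨ast (f.1 * e.1), v' _⟩⟩
    let h : projections S := ⟨ast (g.1 * k.1), ⟨ast (g.1 * k.1), v' _⟩⟩
    show ast (plus (f.1 * h.1) * e.1) = h.1
    have hk : k.1 * h.1 = h.1 := proj_mul_ast k g.1
    have he : e.1 * h.1 = h.1 := by
      rw [← hk, ← IsDRCSemigroup.mul_assoc, show e.1 * k.1 = k.1 from proj_mul_ast e f.1]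
    have hfe : (f.1 * e.1) * h.1 = f.1 * h.1 := by
      rw [IsDRCSemigroup.mul_assoc, he]
    have h1 := IsDRCRestrictionSemigroup.vi' (f.1 * e.1) h.1
    rw [hfe, show ast (f.1 * e.1) * h.1 = h.1 from hk, plus_proj, hfe,
      ← IsDRCSemigroup.mul_assoc, plus_mul_proj] at h1
    rw [h1]
    have h2 := ii' (f.1 * e.1) h.1
    rwa [hfe, show ast (f.1 * e.1) * h.1 = h.1 from hk, ast_proj] at h2)

end DRC

/-- The chain semigroup `𝐒(𝒞(P))`: the arrows of the chain category under `bullet`, `a⁺ = dom a`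
and `a^* = ran a`. -/
noncomputable instance (P : Type u) [ProjOps P] [IsStrongProjectionAlgebra P] :
    BiUnary (ChainCategory P) where
  mul := ChainCategory.bullet
  plus a := ChainCategory.obj a.dom
  ast a := ChainCategory.obj a.ran

/-- The chain semigroup `𝐒(𝒞(P))` determined by `P`. -/
abbrev ChainSemigroup (P : Type u) [ProjOps P] [IsStrongProjectionAlgebra P] : Type u :=
  ChainCategory P

/-! The substance of part (1) is associativity. For three objects it is the defining relation of
`ChainRel`: with e = q × (s × r) and f = (q ⋆ s) ⋆ r, the triple (e, s, f) is admissible, the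
product ([q] • [s]) • [r] is the class of (e, e ⋆ s, f), and [q] • ([s] • [r]) is the class of (e, s
× f, f).

The general case reduces to this one because a product depends on its left factor only through a
right restriction, and on its right factor only through a left restriction (`comp_bullet`,
`bullet_comp`). Associativity with a middle factor x ∘ y therefore follows from associativity around
y and around x separately, with objects in place of the remaining factors (`bullet_comp_bullet`).
Induction along a path handles any middle factor between two objects, the only other input being a
single edge. The outer objects are then replaced by arbitrary arrows. Of the remaining laws, the two
restriction laws say that each left restriction is a right restriction and conversely. Moreover, a
path is the product of its vertices, so projections generate.

For part (2), [p₁, …, p_k] is sent to ι(p₁)⋯ι(p_k). Both sides of an admissible relation evaluate to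
ι(e)ι(p)ι(f). In `S`, restriction becomes multiplication by a projection, and the connecting edge
satisfies ι(p × q)ι(p ⋆ q) = ι(p)ι(q); hence `•` goes to the product of `S`. The image contains the
generators of `S`. -/

open ProjOps IsProjectionAlgebra

/-! ### The order on projections and admissible triples -/

section Laws

variable {P : Type u} [ProjOps P] [IsStrongProjectionAlgebra P]

namespace ProjOps

theorem le.refl (p : P) : le p p := (L1 p).symm

theorem le.trans {p q r : P} (h : le p q) (h' : le q r) : le p r := by
  have h1 := times_mono h r
  rw [show r ×ₚ q = q from h'.symm] at h1
  have h2 : r ×ₚ p = q ×ₚ (r ×ₚ p) := h1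
  have h3 := L4 r q p
  rw [show r ×ₚ q = q from h'.symm, ← h2, show q ×ₚ p = p from h.symm] at h3
  exact h3

theorem F.refl (p : P) : F p p := ⟨L1 p, R1 p⟩

theorem le.star_star {p q : P} (h : le p q) (x : P) : (x ⋆ₚ q) ⋆ₚ p = x ⋆ₚ p := by
  have h1 := R4 q p x
  rw [h.star_eq] at h1
  exact h1.symm

theorem le.star_star' {p q : P} (h : le p q) (x : P) : p ⋆ₚ (q ⋆ₚ x) = p ⋆ₚ x := by
  rw [R4, (star_mono h x).star_eq]

/-- This is the triple produced by a product of three projections. Since (q × (s × r)) ⋆ s = (q ⋆ s)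
× r and s × ((q ⋆ s) ⋆ r) = q ⋆ (s × r), its two conditions are halves of `F_times_star` for (q ⋆ s,
r) and for (q, s × r). -/
theorem admissible_times_star (q s r : P) :
    Admissible (q ×ₚ (s ×ₚ r)) s ((q ⋆ₚ s) ⋆ₚ r) := by
  refine ⟨?_, ?_⟩
  · rw [← star_times_eq]
    exact (F_times_star _ _).2.symm
  · rw [← star_of_times]
    exact (F_times_star _ _).1.symm

theorem admissible_of_le (x s w : P) (h : le w s) :
    Admissible (x ×ₚ w) s (x ⋆ₚ w) := by
  have h1 := admissible_times_star x s w
  rwa [show s ×ₚ w = w from h.symm, h.star_star] at h1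

end ProjOps

end Laws

/-! ### Composition and iterated restriction of paths -/

namespace PPath

section Basic

variable {P : Type u} [ProjOps P]

theorem comp_assoc (a b c : PPath P) (h : a.ran = b.dom) (h' : b.ran = c.dom) :
    (a.comp b h).comp c ((ran_comp _ _ _).trans h') =
      a.comp (b.comp c h') (h.trans (dom_comp _ _ _).symm) := by
  ext1
  simp [comp, List.tail_append_of_ne_nil b.ne]

theorem single_comp (p : P) (a : PPath P) (h : (single p).ran = a.dom) :
    (single p).comp a h = a := by
  obtain rfl : p = a.dom := h
  ext1
  simp [comp, single, dom]

theorem comp_single (a : PPath P) (p : P) (h : a.ran = (single p).dom) : a.comp (single p) h = a := by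
  ext1
  simp [comp, single]

theorem scanl_star_self (t : List P) (p : P) (hc : (p :: t).IsChain F) :
    t.scanl (· ⋆ₚ ·) p = p :: t := by
  induction t generalizing p with
  | nil => simp
  | cons x t ih =>
    rw [List.isChain_cons_cons] at hc
    rw [List.scanl_cons, hc.1.2, ih x hc.2]

end Basic

section Restriction

variable {P : Type u} [ProjOps P] [IsStrongProjectionAlgebra P]

theorem leftRes_self (a : PPath P) : leftRes a.dom a (le.refl _) = a := by
  obtain ⟨l, hl, hc⟩ := a
  cases l with
  | nil => exact absurd rfl hl
  | cons p t =>
    ext1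
    exact scanl_star_self t p hc

theorem scanl_star_scanl (t : List P) (q r : P) (h : le q r) :
    (t.scanl (· ⋆ₚ ·) r).tail.scanl (· ⋆ₚ ·) q = t.scanl (· ⋆ₚ ·) q := by
  induction t generalizing q r with
  | nil => simp
  | cons x t ih =>
    obtain ⟨s, hs⟩ := scanl_head (r ⋆ₚ x) t
    have := ih (q ⋆ₚ x) (r ⋆ₚ x) (star_mono h x)
    rw [hs] at this
    rw [List.scanl_cons, List.scanl_cons, List.tail_cons, hs, List.scanl_cons, h.star_star',
      ← this, List.tail_cons]

theorem leftRes_leftRes (q r : P) (a : PPath P) (hr : le r a.dom) (hq : le q r) :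
    leftRes q (leftRes r a hr) (by rwa [dom_leftRes]) = leftRes q a (hq.trans hr) := by
  ext1
  exact scanl_star_scanl _ _ _ hq

/-- Lets an admissible relation act on the last three vertices of a four-vertex path, as needed for
a product with one edge in the middle. -/
theorem chainRel_cons_four {a b c d c' : P} (hl : [a, b, c, d].IsChain F)
    (hm : [a, b, c', d].IsChain F)
    (h : ∀ h₁ h₂ h₃ h₄, ChainRel (triple b c d h₁ h₂) (triple b c' d h₃ h₄)) :
    ChainRel ⟨[a, b, c, d], by simp, hl⟩ ⟨[a, b, c', d], by simp, hm⟩ := by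
  have hl' := hl
  have hm' := hm
  simp only [List.isChain_cons_cons, List.isChain_singleton, and_true] at hl' hm'
  exact ChainRel.comp_left (pair a b hl'.1) rfl rfl (h hl'.2.1 hl'.2.2 hm'.2.1 hm'.2.2)

theorem chainRel_dup_right {a b c : P} (h : F a b) (h' : F b c) (h'' : F c c) :
    ChainRel ⟨[a, b, c, c], by simp, by simp [h, h', h'']⟩ (triple a b c h h') := by
  have h1 := ChainRel.comp_left (triple a b c h h') rfl rfl (ChainRel.idem c h'')
  have h2 : (triple a b c h h').comp (single c) rfl = triple a b c h h' := comp_single _ _ _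
  exact h2 ▸ h1

end Restriction

end PPath

/-! ### Composition and restriction in the chain category -/

namespace ChainCategory

variable {P : Type u} [ProjOps P] [IsStrongProjectionAlgebra P]

@[simp] theorem dom_obj (p : P) : (obj p).dom = p := rfl
@[simp] theorem ran_obj (p : P) : (obj p).ran = p := rfl
@[simp] theorem dom_eval (p q : P) (h : F p q) : (eval p q h).dom = p := rfl
@[simp] theorem ran_eval (p q : P) (h : F p q) : (eval p q h).ran = q := rfl

theorem obj_injective : Function.Injective (obj : P → ChainCategory P) :=
  fun _ _ h => congrArg dom h

theorem dom_comp (a b : ChainCategory P) (h : a.ran = b.dom) : (comp a b h).dom = a.dom := by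
  obtain ⟨x, rfl⟩ := exists_rep a
  obtain ⟨y, rfl⟩ := exists_rep b
  exact PPath.dom_comp x y h

/-- Composition and restriction take proofs about endpoints as arguments, so equal arguments are
exchanged by this lemma and the next two, which carry those proofs along. -/
theorem comp_congr {a a' b b' : ChainCategory P} (h : a.ran = b.dom) (ha : a = a') (hb : b = b') :
    comp a b h = comp a' b' (by rw [← ha, ← hb, h]) := by
  subst ha hb
  rfl

theorem leftRes_congr {q q' : P} {a a' : ChainCategory P} (h : le q a.dom) (hq : q = q')
    (ha : a = a') : leftRes q a h = leftRes q' a' (by rwa [← ha, ← hq]) := by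
  subst ha hq
  rfl

theorem rightRes_congr {q q' : P} {a a' : ChainCategory P} (h : le q a.ran) (ha : a = a')
    (hq : q = q') : rightRes a q h = rightRes a' q' (by rwa [← ha, ← hq]) := by
  subst ha hq
  rfl

theorem comp_assoc (a b c : ChainCategory P) (h : a.ran = b.dom) (h' : b.ran = c.dom) :
    comp (comp a b h) c ((ran_comp _ _ _).trans h') =
      comp a (comp b c h') (h.trans (dom_comp _ _ _).symm) := by
  obtain ⟨x, rfl⟩ := exists_rep a
  obtain ⟨y, rfl⟩ := exists_rep b
  obtain ⟨z, rfl⟩ := exists_rep c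
  exact congrArg mk (PPath.comp_assoc x y z h h')

theorem obj_comp (p : P) (a : ChainCategory P) (h : p = a.dom) : comp (obj p) a h = a := by
  obtain ⟨x, rfl⟩ := exists_rep a
  exact congrArg mk (PPath.single_comp p x h)

theorem comp_obj (a : ChainCategory P) (p : P) (h : a.ran = p) : comp a (obj p) h = a := by
  obtain ⟨x, rfl⟩ := exists_rep a
  exact congrArg mk (PPath.comp_single x p h)

theorem eval_self (p : P) (h : F p p) : eval p p h = obj p := mk_eq_mk.2 (ChainRel.idem p h)

theorem eval_of_eq {p q : P} (h : F p q) (e : p = q) : eval p q h = obj p := by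
  subst e
  exact eval_self p h

theorem ran_leftRes_le (q : P) (a : ChainCategory P) (h : le q a.dom) :
    le (leftRes q a h).ran a.ran := by
  obtain ⟨x, rfl⟩ := exists_rep a
  rw [leftRes_mk]
  exact PPath.ran_leftRes_le q x h

theorem dom_rightRes_le (a : ChainCategory P) (q : P) (h : le q a.ran) :
    le (rightRes a q h).dom a.dom := by
  obtain ⟨x, rfl⟩ := exists_rep a
  rw [rightRes_mk]
  exact PPath.dom_rightRes_le x q h

theorem leftRes_eq_rightRes (q : P) (a : ChainCategory P) (h : le q a.dom) :
    leftRes q a h = rightRes a (leftRes q a h).ran (ran_leftRes_le q a h) := by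
  obtain ⟨x, rfl⟩ := exists_rep a
  simp only [leftRes_mk, rightRes_mk]
  exact congrArg mk (PPath.leftRes_eq_rightRes q x h)

theorem rightRes_eq_leftRes (a : ChainCategory P) (q : P) (h : le q a.ran) :
    rightRes a q h = leftRes (rightRes a q h).dom a (dom_rightRes_le a q h) := by
  obtain ⟨x, rfl⟩ := exists_rep a
  simp only [leftRes_mk, rightRes_mk]
  exact congrArg mk (PPath.rightRes_eq_leftRes x q h)

theorem leftRes_self (a : ChainCategory P) {q : P} (h : le q a.dom) (hq : q = a.dom) :
    leftRes q a h = a := by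
  subst hq
  obtain ⟨x, rfl⟩ := exists_rep a
  rw [leftRes_mk]
  exact congrArg mk (PPath.leftRes_self x)

theorem rightRes_self (a : ChainCategory P) {q : P} (h : le q a.ran) (hq : q = a.ran) :
    rightRes a q h = a := by
  subst hq
  have h1 := leftRes_eq_rightRes a.dom a (le.refl _)
  have h2 := leftRes_self a (le.refl _) rfl
  exact ((rightRes_congr _ rfl (congrArg ran h2)).symm.trans h1.symm).trans h2

theorem leftRes_leftRes (q r : P) (a : ChainCategory P) (hr : le r a.dom)
    (hq : le q (leftRes r a hr).dom) :
    leftRes q (leftRes r a hr) hq = leftRes q a (by rw [dom_leftRes] at hq; exact hq.trans hr) := by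
  obtain ⟨x, rfl⟩ := exists_rep a
  rw [dom_leftRes] at hq
  simp only [leftRes_mk]
  exact congrArg mk (PPath.leftRes_leftRes q r x hr hq)

theorem leftRes_comp (q : P) (a b : ChainCategory P) (h : a.ran = b.dom)
    (hq : le q (comp a b h).dom) :
    leftRes q (comp a b h) hq =
      comp (leftRes q a (by rwa [dom_comp] at hq))
        (leftRes (leftRes q a (by rwa [dom_comp] at hq)).ran b (h ▸ ran_leftRes_le _ _ _))
        (dom_leftRes _ _ _).symm := by
  obtain ⟨x, rfl⟩ := exists_rep a
  obtain ⟨y, rfl⟩ := exists_rep b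
  simp only [comp_mk, leftRes_mk]
  exact congrArg mk (PPath.leftRes_comp q x y h hq)

/-- Each right restriction is a left restriction to its own domain, so the statement transfers from
`leftRes_leftRes`; the range of the result is then forced to be q. -/
theorem rightRes_rightRes (q r : P) (a : ChainCategory P) (hr : le r a.ran)
    (hq : le q (rightRes a r hr).ran) :
    rightRes (rightRes a r hr) q hq =
      rightRes a q (by rw [ran_rightRes] at hq; exact hq.trans hr) := by
  have h1 := rightRes_eq_leftRes (rightRes a r hr) q hq
  rw [leftRes_congr _ rfl (rightRes_eq_leftRes a r hr), leftRes_leftRes,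
    leftRes_eq_rightRes] at h1
  refine h1.trans (rightRes_congr _ rfl ?_)
  have h2 := congrArg ran h1
  rw [ran_rightRes, ran_rightRes] at h2
  exact h2.symm

theorem rightRes_comp (a b : ChainCategory P) (q : P) (h : a.ran = b.dom)
    (hq : le q (comp a b h).ran) :
    rightRes (comp a b h) q hq =
      comp (rightRes a (rightRes b q (by rwa [ran_comp] at hq)).dom (h ▸ dom_rightRes_le _ _ _))
        (rightRes b q (by rwa [ran_comp] at hq))
        (ran_rightRes _ _ _) := by
  have hqb : le q b.ran := by rwa [ran_comp] at hq
  have ht : le (rightRes b q hqb).dom a.ran := h ▸ dom_rightRes_le _ _ _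
  have hs : le (rightRes a _ ht).dom (comp a b h).dom := by
    rw [dom_comp]
    exact dom_rightRes_le _ _ _
  -- The right restriction of a ∘ b to q must start where the restriction of a ends up starting, so
  -- it is computed as a left restriction from that point.
  have h1 := leftRes_comp (rightRes a _ ht).dom a b h hs
  have h2 : leftRes (rightRes a _ ht).dom a (dom_rightRes_le _ _ _) = rightRes a _ ht :=
    (rightRes_eq_leftRes _ _ _).symm
  have h3 := h1.trans (comp_congr _ h2 ((leftRes_congr _
    ((congrArg ran h2).trans (ran_rightRes _ _ _)) rfl).trans (rightRes_eq_leftRes b q hqb).symm))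
  rw [← h3, leftRes_eq_rightRes]
  refine rightRes_congr _ rfl ?_
  rw [h3, ran_comp, ran_rightRes]

end ChainCategory

/-! ### The product of the chain semigroup and its associativity -/

namespace ChainCategory

variable {P : Type u} [ProjOps P] [IsStrongProjectionAlgebra P]

@[simp] theorem dom_bullet (a b : ChainCategory P) :
    (bullet a b).dom = (rightRes a (a.ran ×ₚ b.dom) (times_le _ _)).dom := by
  exact (dom_comp _ _ _).trans (dom_comp _ _ _)

@[simp] theorem ran_bullet (a b : ChainCategory P) :
    (bullet a b).ran = (leftRes (a.ran ⋆ₚ b.dom) b (star_le _ _)).ran := by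
  exact ran_comp _ _ _

theorem dom_bullet_le (a b : ChainCategory P) : le (bullet a b).dom a.dom := by
  rw [dom_bullet]
  exact dom_rightRes_le _ _ _

theorem ran_bullet_le (a b : ChainCategory P) : le (bullet a b).ran b.ran := by
  rw [ran_bullet]
  exact ran_leftRes_le _ _ _

theorem rightRes_obj (p q : P) (h : le q (obj p).ran) : rightRes (obj p) q h = obj q :=
  (rightRes_mk _ _ _).trans (congrArg mk (by ext1; simp [PPath.rightRes, PPath.single]))

theorem leftRes_obj (p q : P) (h : le q (obj p).dom) : leftRes q (obj p) h = obj q :=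
  (leftRes_mk _ _ _).trans (congrArg mk (by ext1; simp [PPath.leftRes, PPath.single]))

theorem obj_bullet (p : P) (a : ChainCategory P) :
    bullet (obj p) a = comp (eval (p ×ₚ a.dom) (p ⋆ₚ a.dom) (F_times_star _ _))
      (leftRes (p ⋆ₚ a.dom) a (star_le _ _)) (dom_leftRes _ _ _).symm := by
  refine comp_congr _ ?_ rfl
  exact (comp_congr _ (rightRes_obj _ _ _) rfl).trans (obj_comp _ _ _)

theorem bullet_obj (a : ChainCategory P) (p : P) :
    bullet a (obj p) = comp (rightRes a (a.ran ×ₚ p) (times_le _ _))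
      (eval (a.ran ×ₚ p) (a.ran ⋆ₚ p) (F_times_star _ _)) (ran_rightRes _ _ _) := by
  refine (comp_congr _ rfl (leftRes_obj _ _ _)).trans ?_
  exact comp_obj _ _ _

theorem obj_bullet_obj (p q : P) :
    bullet (obj p) (obj q) = eval (p ×ₚ q) (p ⋆ₚ q) (F_times_star _ _) := by
  rw [obj_bullet]
  exact (comp_congr _ rfl (leftRes_obj _ _ _)).trans (comp_obj _ _ _)

/-- For p ≤ dom a both ends of the connecting edge equal p, so the edge collapses to an identity. -/
theorem obj_bullet_of_le (p : P) (a : ChainCategory P) (h : le p a.dom) :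
    bullet (obj p) a = leftRes p a h := by
  rw [obj_bullet]
  refine (comp_congr _ (eval_of_eq _ (h.times_eq.trans h.star_eq.symm))
    (leftRes_congr _ h.star_eq rfl)).trans ?_
  exact obj_comp _ _ _

theorem bullet_obj_of_le (a : ChainCategory P) (p : P) (h : le p a.ran) :
    bullet a (obj p) = rightRes a p h := by
  have h1 : a.ran ×ₚ p = p := h.symm
  rw [bullet_obj]
  refine (comp_congr _ (rightRes_congr _ rfl h1)
    (eval_of_eq _ (h1.trans h.star_eq'.symm))).trans ?_
  exact comp_obj _ _ _

/-- The connecting edge depends on x ∘ y only through dom x, and left restriction passes through the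
composition. -/
theorem bullet_comp (a x y : ChainCategory P) (h : x.ran = y.dom) :
    bullet a (comp x y h) = comp (bullet a x)
      (leftRes (bullet a x).ran y (h ▸ ran_bullet_le _ _)) (dom_leftRes _ _ _).symm := by
  have h1 := dom_comp x y h
  have h2 : bullet a (comp x y h) = comp (comp (rightRes a (a.ran ×ₚ x.dom) (times_le _ _))
      (eval (a.ran ×ₚ x.dom) (a.ran ⋆ₚ x.dom) (F_times_star _ _)) (ran_rightRes _ _ _))
      (leftRes (a.ran ⋆ₚ x.dom) (comp x y h) (by rw [h1]; exact star_le _ _))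
      ((ran_comp _ _ _).trans (dom_leftRes _ _ _).symm) := by
    simp only [bullet, h1]
  have h3 := leftRes_comp (a.ran ⋆ₚ x.dom) x y h (by rw [h1]; exact star_le _ _)
  rw [h2, comp_congr _ rfl h3, ← comp_assoc]
  exact comp_congr _ rfl (leftRes_congr _ (ran_bullet _ _).symm rfl)

theorem comp_bullet (x y b : ChainCategory P) (h : x.ran = y.dom) :
    bullet (comp x y h) b = comp (rightRes x (bullet y b).dom (h ▸ dom_bullet_le _ _))
      (bullet y b) (ran_rightRes _ _ _) := by
  have h1 := ran_comp x y h
  have h2 : bullet (comp x y h) b = comp (comp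
      (rightRes (comp x y h) (y.ran ×ₚ b.dom) (by rw [h1]; exact times_le _ _))
      (eval (y.ran ×ₚ b.dom) (y.ran ⋆ₚ b.dom) (F_times_star _ _)) (ran_rightRes _ _ _))
      (leftRes (y.ran ⋆ₚ b.dom) b (star_le _ _))
      ((ran_comp _ _ _).trans (dom_leftRes _ _ _).symm) := by
    simp only [bullet, h1]
  have h3 := rightRes_comp x y (y.ran ×ₚ b.dom) h (by rw [h1]; exact times_le _ _)
  have h4 := comp_assoc (rightRes x (rightRes y _ (times_le y.ran b.dom)).dom
    (h ▸ dom_rightRes_le _ _ _)) (rightRes y _ (times_le y.ran b.dom))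
    (eval _ _ (F_times_star y.ran b.dom)) (ran_rightRes _ _ _) (ran_rightRes _ _ _)
  refine h2.trans ((comp_congr _ ((comp_congr _ h3 rfl).trans h4) rfl).trans
    ((comp_assoc _ _ _ _ ?_).trans ?_))
  · exact (ran_comp _ _ _).trans (dom_leftRes _ _ _).symm
  · exact comp_congr _ (rightRes_congr _ rfl (dom_bullet _ _).symm) rfl

/-- A product only sees its left factor through the action of its range. -/
theorem bullet_eq_rightRes_comp (a b : ChainCategory P) :
    bullet a b = comp (rightRes a (bullet (obj a.ran) b).dom (dom_bullet_le _ _))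
      (bullet (obj a.ran) b) (ran_rightRes _ _ _) := by
  have := comp_bullet a (obj a.ran) b rfl
  rwa [comp_obj _ _ rfl] at this

/-- A product only sees its right factor through the action of its domain. -/
theorem bullet_eq_comp_leftRes (a b : ChainCategory P) :
    bullet a b = comp (bullet a (obj b.dom))
      (leftRes (bullet a (obj b.dom)).ran b (ran_bullet_le _ _)) (dom_leftRes _ _ _).symm := by
  have := bullet_comp a (obj b.dom) b rfl
  rwa [obj_comp _ _ rfl] at this

/-- The two bracketings are literally the two sides of the generating pair attached to
`admissible_times_star`. -/
theorem obj_bullet_obj_bullet_obj (q s r : P) :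
    bullet (bullet (obj q) (obj s)) (obj r) = bullet (obj q) (bullet (obj s) (obj r)) := by
  have h := admissible_times_star q s r
  have hl : bullet (bullet (obj q) (obj s)) (obj r) =
      mk (PPath.triple _ _ _ h.F₁ h.F₂) := by
    rw [obj_bullet_obj, bullet_obj]
    simp only [eval, rightRes_mk, comp_mk]
    refine congrArg mk (PPath.ext ?_)
    have e1 : (q ×ₚ s) ×ₚ ((q ⋆ₚ s) ×ₚ r) = q ×ₚ (s ×ₚ r) := by
      rw [← times_star q s, P3r, ← L3]
    have e2 : (q ×ₚ (s ×ₚ r)) ⋆ₚ s = (q ⋆ₚ s) ×ₚ r := (star_times_eq _ _ _).symm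
    simp [PPath.comp, PPath.rightRes, PPath.pair, PPath.triple, PPath.ran, e1, e2]
  have hr : bullet (obj q) (bullet (obj s) (obj r)) =
      mk (PPath.triple _ _ _ h.F₃ h.F₄) := by
    rw [obj_bullet_obj, obj_bullet]
    simp only [eval, leftRes_mk, comp_mk]
    refine congrArg mk (PPath.ext ?_)
    have e1 : (q ⋆ₚ (s ×ₚ r)) ⋆ₚ (s ⋆ₚ r) = (q ⋆ₚ s) ⋆ₚ r := by
      rw [← star_times s r, P3l, ← R3]
    have e2 := star_of_times r s q
    simp [PPath.comp, PPath.leftRes, PPath.pair, PPath.triple, PPath.dom, e1, ← e2]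
  rw [hl, hr]
  exact mk_eq_mk.2 (ChainRel.adm _ _ _ h)

/-- The left side is a four-vertex path and the right side has three vertices; two admissible
relations and one deletion of a repeated vertex connect them. Only w ≤ s is needed, since
`bullet_comp_bullet` uses this case only for such w. -/
theorem obj_bullet_eval_bullet_obj (q e s w : P) (h : F e s) (hw : le w s) :
    bullet (bullet (obj q) (eval e s h)) (obj w) =
      bullet (obj q) (bullet (eval e s h) (obj w)) := by
  have hA := admissible_times_star q e w
  have hB := admissible_of_le (q ⋆ₚ e) s w hw
  have hA' : (q ×ₚ (e ×ₚ w)) ⋆ₚ e = (q ⋆ₚ e) ×ₚ w := (star_times_eq _ _ _).symm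
  have hB' : s ×ₚ ((q ⋆ₚ e) ⋆ₚ w) = (q ⋆ₚ e) ⋆ₚ w := ((star_le _ _).trans hw).symm
  have hAB := hA' ▸ hA.F₁
  have c1 : [q ×ₚ (e ×ₚ w), (q ⋆ₚ e) ×ₚ w, ((q ⋆ₚ e) ×ₚ w) ⋆ₚ s, (q ⋆ₚ e) ⋆ₚ w].IsChain F := by
    simpa using ⟨hAB, hB.F₁, hB.F₂⟩
  have c2 : [q ×ₚ (e ×ₚ w), (q ⋆ₚ e) ×ₚ w, s ×ₚ ((q ⋆ₚ e) ⋆ₚ w), (q ⋆ₚ e) ⋆ₚ w].IsChain F := by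
    simpa using ⟨hAB, hB.F₃, hB.F₄⟩
  have hl : bullet (bullet (obj q) (eval e s h)) (obj w) = mk ⟨_, by simp, c1⟩ := by
    rw [obj_bullet]
    simp only [eval, leftRes_mk, comp_mk]
    rw [bullet_obj]
    simp only [eval, rightRes_mk, comp_mk]
    refine congrArg mk (PPath.ext ?_)
    have e0 : ((q ⋆ₚ e) ⋆ₚ s) ×ₚ w = ((q ⋆ₚ e) ×ₚ w) ⋆ₚ s := by
      rw [star_times_eq, show s ×ₚ w = w from hw.symm]
    have e1 : (q ⋆ₚ e) ×ₚ (((q ⋆ₚ e) ×ₚ w) ⋆ₚ s) = (q ⋆ₚ e) ×ₚ w := by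
      rw [← e0, P3r, show s ×ₚ w = w from hw.symm]
    have e2 : (q ×ₚ e) ×ₚ ((q ⋆ₚ e) ×ₚ w) = q ×ₚ (e ×ₚ w) := by
      rw [← times_star q e, P3r, ← L3]
    simp [PPath.comp, PPath.rightRes, PPath.leftRes, PPath.pair, PPath.ran, PPath.dom,
      hw.star_star, e0, e1, e2]
  have hr : bullet (obj q) (bullet (eval e s h) (obj w)) = mk (PPath.triple _ _ _ hA.F₃ hA.F₄) := by
    rw [bullet_obj_of_le _ _ hw]
    simp only [eval, rightRes_mk]
    rw [obj_bullet]
    simp only [eval, leftRes_mk, comp_mk]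
    refine congrArg mk (PPath.ext ?_)
    have e1 : (q ⋆ₚ (e ×ₚ w)) ⋆ₚ w = (q ⋆ₚ e) ⋆ₚ w := P3l _ _ _
    have e2 := star_of_times w e q
    simp [PPath.comp, PPath.rightRes, PPath.leftRes, PPath.pair, PPath.triple, PPath.dom, e1, ← e2]
  rw [hl, hr, mk_eq_mk]
  -- The relation for `hB` replaces the third vertex by s × ((q ⋆ e) ⋆ w), which by `hB'` repeats
  -- the last vertex. Deleting the repetition leaves the first side of the relation for `hA`.
  refine (PPath.chainRel_cons_four c1 c2 fun _ _ _ _ => ChainRel.adm _ _ _ hB).trans ?_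
  refine ChainRel.trans ?_ (ChainRel.adm _ _ _ hA)
  have h1 := PPath.chainRel_dup_right hAB (F_times_star (q ⋆ₚ e) w) (F.refl _)
  simpa only [hA', hB'] using h1

/-- With w = dom (y • b), both bracketings equal (a • x) • [w] followed by the matching left
restriction of y • b. On the left side `hy` is applied with z = ran (a • x), where left restriction
of y to z is [z] • y; on the right side `hx` is applied to x • [w], the right restriction of x to w.
-/
theorem bullet_comp_bullet (a x y b : ChainCategory P) (h : x.ran = y.dom)
    (hy : ∀ z, bullet (bullet (obj z) y) b = bullet (obj z) (bullet y b))
    (hx : ∀ w, le w x.ran → bullet (bullet a x) (obj w) = bullet a (bullet x (obj w))) :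
    bullet (bullet a (comp x y h)) b = bullet a (bullet (comp x y h) b) := by
  have hz : le (bullet a x).ran y.dom := h ▸ ran_bullet_le _ _
  have hw : le (bullet y b).dom x.ran := h ▸ dom_bullet_le _ _
  have h1 : bullet (leftRes (bullet a x).ran y hz) b =
      bullet (obj (bullet a x).ran) (bullet y b) := by
    rw [← obj_bullet_of_le, hy]
  have h2 := bullet_eq_comp_leftRes (obj (bullet a x).ran) (bullet y b)
  have h3 := bullet_eq_rightRes_comp (bullet a x) (obj (bullet y b).dom)
  have h4 : (bullet (bullet a x) (obj (bullet y b).dom)).ran =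
      (bullet (obj (bullet a x).ran) (obj (bullet y b).dom)).ran := by
    simp only [ran_bullet, ran_obj]
  have hl : bullet (bullet a (comp x y h)) b = comp (bullet (bullet a x) (obj (bullet y b).dom))
      (leftRes (bullet (bullet a x) (obj (bullet y b).dom)).ran (bullet y b) (ran_bullet_le _ _))
      (dom_leftRes _ _ _).symm := by
    rw [bullet_comp, comp_bullet]
    have h5 : (bullet (leftRes (bullet a x).ran y hz) b).dom =
        (bullet (obj (bullet a x).ran) (obj (bullet y b).dom)).dom :=
      (congrArg dom (h1.trans h2)).trans (dom_comp _ _ _)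
    have h6 := comp_assoc (rightRes (bullet a x)
        (bullet (obj (bullet a x).ran) (obj (bullet y b).dom)).dom (dom_bullet_le _ _))
      (bullet (obj (bullet a x).ran) (obj (bullet y b).dom))
      (leftRes (bullet (obj (bullet a x).ran) (obj (bullet y b).dom)).ran (bullet y b)
        (ran_bullet_le _ _)) (ran_rightRes _ _ _) (dom_leftRes _ _ _).symm
    exact (comp_congr _ (rightRes_congr _ rfl h5) (h1.trans h2)).trans
      (h6.symm.trans (comp_congr _ h3.symm (leftRes_congr _ h4.symm rfl)))
  have h5 : rightRes x (bullet y b).dom hw = bullet x (obj (bullet y b).dom) :=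
    (bullet_obj_of_le _ _ hw).symm
  have h6 : bullet a (rightRes x (bullet y b).dom hw) =
      bullet (bullet a x) (obj (bullet y b).dom) := by
    rw [h5, hx _ hw]
  rw [hl, comp_bullet, bullet_comp]
  exact (comp_congr _ h6 (leftRes_congr _ (congrArg ran h6) rfl)).symm

/-- The first edge is split off and glued back by `bullet_comp_bullet`. The induction keeps q
general because the gluing needs the shorter path with every object on its left. -/
theorem obj_bullet_path_bullet_obj (t : List P) (e : P) (hc : (e :: t).IsChain F) (q r : P) :
    bullet (bullet (obj q) (mk ⟨e :: t, by simp, hc⟩)) (obj r) =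
      bullet (obj q) (bullet (mk ⟨e :: t, by simp, hc⟩) (obj r)) := by
  induction t generalizing e q with
  | nil => exact obj_bullet_obj_bullet_obj q e r
  | cons s t ih =>
    have hc' := List.isChain_cons_cons.1 hc
    have hx : mk ⟨e :: s :: t, by simp, hc⟩ =
      comp (eval e s hc'.1) (mk ⟨s :: t, by simp, hc'.2⟩) rfl := rfl
    rw [hx]
    exact bullet_comp_bullet _ _ _ _ _ (ih s hc'.2)
      (fun w hw => obj_bullet_eval_bullet_obj q e s w hc'.1 hw)

theorem obj_bullet_bullet_obj (q : P) (a : ChainCategory P) (r : P) :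
    bullet (bullet (obj q) a) (obj r) = bullet (obj q) (bullet a (obj r)) := by
  obtain ⟨⟨l, hl, hc⟩, rfl⟩ := exists_rep a
  cases l with
  | nil => exact absurd rfl hl
  | cons e t => exact obj_bullet_path_bullet_obj t e hc q r

/-- Writing a • b as a restriction of a followed by [ran a] • b reduces this to the case where the
left factor is an object. -/
theorem bullet_bullet_obj (a b : ChainCategory P) (r : P) :
    bullet (bullet a b) (obj r) = bullet a (bullet b (obj r)) := by
  have h1 := obj_bullet_bullet_obj a.ran b r
  have h2 := comp_bullet _ _ (obj r)
    (ran_rightRes a (bullet (obj a.ran) b).dom (dom_bullet_le _ _))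
  rw [← bullet_eq_rightRes_comp a b] at h2
  rw [h2, bullet_eq_rightRes_comp a (bullet b (obj r))]
  exact comp_congr _ ((rightRes_rightRes _ _ _ _ _).trans
    (rightRes_congr _ rfl (congrArg dom h1))) h1

theorem bullet_assoc (a b c : ChainCategory P) :
    bullet (bullet a b) c = bullet a (bullet b c) := by
  have h1 := bullet_bullet_obj a b c.dom
  have h2 := bullet_comp a _ _
    (dom_leftRes (bullet b (obj c.dom)).ran c (ran_bullet_le _ _)).symm
  rw [← bullet_eq_comp_leftRes b c] at h2
  rw [h2, bullet_eq_comp_leftRes (bullet a b) c]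
  exact comp_congr _ h1 ((leftRes_congr _ (congrArg ran h1) rfl).trans
    (leftRes_leftRes _ _ _ _ _).symm)

/-! ### The DRC-restriction laws, projections and generation -/

section Semigroup

open BiUnary

theorem mul_def (a b : ChainCategory P) : a * b = bullet a b := rfl
theorem plus_def (a : ChainCategory P) : plus a = obj a.dom := rfl
theorem ast_def (a : ChainCategory P) : ast a = obj a.ran := rfl

theorem obj_mul_of_le (p : P) (a : ChainCategory P) (h : le p a.dom) :
    obj p * a = leftRes p a h := obj_bullet_of_le p a h

theorem mul_obj_of_le (a : ChainCategory P) (p : P) (h : le p a.ran) :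
    a * obj p = rightRes a p h := bullet_obj_of_le a p h

theorem obj_mul_obj_of_le {p q : P} (h : le p q) : obj p * obj q = obj p :=
  (obj_mul_of_le p (obj q) h).trans (leftRes_obj _ _ _)

theorem obj_mul_obj_of_ge {p q : P} (h : le p q) : obj q * obj p = obj p :=
  (mul_obj_of_le (obj q) p h).trans (rightRes_obj _ _ _)

/-- Multiplying by an object below an endpoint is restriction. Hence both sides of `vi` are one
restriction of a, described from its range and from its domain; `vi'` is dual. -/
instance : IsDRCRestrictionSemigroup (ChainSemigroup P) where
  mul_assoc := bullet_assoc
  i a := (obj_mul_of_le _ _ (le.refl _)).trans (leftRes_self _ _ rfl)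
  i' a := (mul_obj_of_le _ _ (le.refl _)).trans (rightRes_self _ _ rfl)
  ii a b := by
    simp only [mul_def, plus_def, dom_bullet, dom_obj]
  ii' a b := by
    simp only [mul_def, ast_def, ran_bullet, ran_obj]
  iii a b := by
    rw [plus_def, plus_def, mul_def a b, obj_mul_obj_of_ge (dom_bullet_le a b),
      obj_mul_obj_of_le (dom_bullet_le a b)]
  iii' a b := by
    rw [ast_def, ast_def, mul_def a b, obj_mul_obj_of_ge (ran_bullet_le a b),
      obj_mul_obj_of_le (ran_bullet_le a b)]
  iv _ := rfl
  iv' _ := rfl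
  v _ := rfl
  v' _ := rfl
  vi a b := by
    have h : (bullet b (obj a.dom)).ran = b.ran ⋆ₚ a.dom := by
      rw [ran_bullet, leftRes_obj]
      rfl
    simp only [plus_def, ast_def, mul_def, h, ran_bullet]
    rw [bullet_obj_of_le _ _ (ran_leftRes_le _ _ _), obj_bullet_of_le _ _ (star_le _ _)]
    exact (leftRes_eq_rightRes _ _ _).symm
  vi' a b := by
    have h : (bullet (obj a.ran) b).dom = a.ran ×ₚ b.dom := by
      rw [dom_bullet, rightRes_obj]
      rfl
    simp only [plus_def, ast_def, mul_def, h, dom_bullet]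
    rw [bullet_obj_of_le _ _ (times_le _ _), obj_bullet_of_le _ _ (dom_rightRes_le _ _ _)]
    exact (rightRes_eq_leftRes _ _ _).symm

theorem projections_eq_range_obj :
    projections (ChainSemigroup P) = Set.range (obj : P → ChainSemigroup P) := by
  ext a
  constructor
  · rintro ⟨b, rfl⟩
    exact ⟨b.dom, rfl⟩
  · rintro ⟨p, rfl⟩
    exact ⟨obj p, rfl⟩

/-- As p × q = p and p ⋆ q = q, the connecting edge is (p, q) itself and the tail is not restricted.
-/
theorem mk_cons (p q : P) (t : List P) (hc : (p :: q :: t).IsChain F) :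
    mk ⟨p :: q :: t, by simp, hc⟩ =
      (obj p * mk ⟨q :: t, by simp, (List.isChain_cons_cons.1 hc).2⟩ : ChainSemigroup P) := by
  obtain ⟨h, h'⟩ := List.isChain_cons_cons.1 hc
  rw [mul_def, obj_bullet]
  have e1 : p ×ₚ (mk ⟨q :: t, by simp, h'⟩).dom = p := h.1
  have e2 : p ⋆ₚ (mk ⟨q :: t, by simp, h'⟩).dom = q := h.2
  simp only [e1, e2]
  exact (comp_congr (a' := eval p q h) _ rfl
    (leftRes_self (mk ⟨q :: t, by simp, h'⟩) (q := q) (le.refl _) rfl)).symm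

theorem isProjectionGenerated : IsProjectionGenerated (ChainSemigroup P) := by
  refine (Subsemigroup.eq_top_iff' _).2 fun a => ?_
  have hobj : ∀ p : P, obj p ∈ Subsemigroup.closure (projections (ChainSemigroup P)) :=
    fun p => Subsemigroup.subset_closure ⟨obj p, rfl⟩
  obtain ⟨⟨l, hl, hc⟩, rfl⟩ := exists_rep a
  induction l with
  | nil => exact absurd rfl hl
  | cons p t ih =>
    cases t with
    | nil => exact hobj p
    | cons q t =>
      rw [mk_cons]
      exact mul_mem (hobj p) (ih (by simp) _)

/-- The isomorphism `p ↦ [p]` from `P` onto the projection algebra of its chain semigroup. -/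
noncomputable def projIso : ProjIso P (projections (ChainSemigroup P)) where
  toEquiv := Equiv.ofBijective (fun p => ⟨obj p, obj p, rfl⟩)
    ⟨fun _ _ h => obj_injective (congrArg Subtype.val h),
      fun ⟨_, a, h⟩ => ⟨a.dom, Subtype.ext h⟩⟩
  map_times p q := Subtype.ext (by
    show obj (p ×ₚ q) = obj (bullet (obj p) (obj q)).dom
    rw [obj_bullet_obj, dom_eval])
  map_star p q := Subtype.ext (by
    show obj (p ⋆ₚ q) = obj (bullet (obj p) (obj q)).ran
    rw [obj_bullet_obj, ran_eval])

end Semigroup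

end ChainCategory

/-! ### Evaluation of chains in a projection-generated semigroup -/

section Universal

open BiUnary
open IsDRCSemigroup hiding mul_assoc

variable {P : Type u} [ProjOps P]
variable {S : Type v} [BiUnary S]

/-- `listEval ι t p` is the product `ι(p) ι(t₁) ⋯ ι(t_k)` for `t = [t₁, …, t_k]`. -/
def listEval (ι : P → S) : List P → P → S
  | [], p => ι p
  | q :: t, p => ι p * listEval ι t q

/-- The evaluation `ι(p₁) ⋯ ι(p_k)` of a path `(p₁, …, p_k)` in `S`. -/
def PPath.evalIn (ι : P → S) (a : PPath P) : S := listEval ι a.toList.tail a.dom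

variable [IsDRCRestrictionSemigroup S] (ι : ProjIso P (projections S))

namespace ProjIso

/-- The projection of `S` that corresponds to `p`. -/
def val (p : P) : S := (ι.toFun p).1

theorem plus_val (p : P) : plus (ι.val p) = ι.val p := plus_proj _

theorem ast_val (p : P) : ast (ι.val p) = ι.val p := ast_proj _

theorem val_mul_self (p : P) : ι.val p * ι.val p = ι.val p := mul_self_proj _

theorem val_times (p q : P) : ι.val (p ×ₚ q) = plus (ι.val p * ι.val q) :=
  congrArg Subtype.val (ι.map_times p q)

theorem val_star (p q : P) : ι.val (p ⋆ₚ q) = ast (ι.val p * ι.val q) :=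
  congrArg Subtype.val (ι.map_star p q)

theorem val_times_mul (p q : P) : ι.val (p ×ₚ q) * ι.val q = ι.val p * ι.val q := by
  rw [val_times]
  exact plus_mul_right _ _

theorem val_mul_star (p q : P) : ι.val p * ι.val (p ⋆ₚ q) = ι.val p * ι.val q := by
  rw [val_star]
  exact mul_ast_left _ _

theorem val_mul_listEval (p : P) (t : List P) :
    ι.val p * listEval ι.val t p = listEval ι.val t p := by
  cases t with
  | nil => exact val_mul_self ι p
  | cons q t => rw [listEval, ← IsDRCSemigroup.mul_assoc, val_mul_self]

theorem plus_evalIn (a : PPath P) : plus (a.evalIn ι.val) = ι.val a.dom := by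
  obtain ⟨l, hl, hc⟩ := a
  induction l with
  | nil => exact absurd rfl hl
  | cons p t ih =>
    cases t with
    | nil => exact plus_val ι p
    | cons q t =>
      have hc' := List.isChain_cons_cons.1 hc
      have h1 := ih (by simp) hc'.2
      show plus (ι.val p * (PPath.evalIn ι.val ⟨q :: t, by simp, hc'.2⟩)) = ι.val p
      rw [ii, h1]
      exact (val_times ι p q).symm.trans (congrArg ι.val hc'.1.1)

/-- The vertex shared by the two factors is counted twice on the right, which is harmless because
projections are idempotent. -/
theorem listEval_append (p : P) (l t : List P) :
    listEval ι.val (l ++ t) p =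
      listEval ι.val l p * listEval ι.val t ((p :: l).getLast (by simp)) := by
  induction l generalizing p with
  | nil => exact (val_mul_listEval ι p t).symm
  | cons q l ih =>
    rw [List.cons_append, listEval, listEval, ih, IsDRCSemigroup.mul_assoc]
    simp

/-- Evaluation of paths is multiplicative on composable pairs. -/
theorem evalIn_comp (a b : PPath P) (h : a.ran = b.dom) :
    (a.comp b h).evalIn ι.val = a.evalIn ι.val * b.evalIn ι.val := by
  obtain ⟨l, hl, hc⟩ := a
  cases l with
  | nil => exact absurd rfl hl
  | cons p t =>
    rw [PPath.evalIn, PPath.dom_comp]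
    refine (listEval_append ι p t b.toList.tail).trans ?_
    rw [show (p :: t).getLast _ = b.dom from h]
    rfl

theorem ast_evalIn (a : PPath P) : ast (a.evalIn ι.val) = ι.val a.ran := by
  obtain ⟨l, hl, hc⟩ := a
  cases l with
  | nil => exact absurd rfl hl
  | cons p t =>
    show ast (listEval ι.val t p) = ι.val ((p :: t).getLast hl)
    -- The path is shortened at its right end because (xy)^* depends on x only through x^*.
    induction t using List.reverseRecOn with
    | nil => exact ast_val ι p
    | append_singleton t x ih =>
      have hc' : ((p :: t) ++ [x]).IsChain F := hc
      have h1 := ih (by simp) hc'.left_of_append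
      rw [listEval_append, ii', h1]
      rw [List.isChain_append] at hc'
      have h2 : F ((p :: t).getLast (by simp)) x :=
        hc'.2.2 _ (by rw [List.getLast?_eq_getLast_of_ne_nil]; rfl) x (by simp)
      have h3 : ast (ι.val ((p :: t).getLast (by simp)) *
          (ι.val ((p :: t).getLast (by simp)) * ι.val x)) = ι.val x := by
        rw [← IsDRCSemigroup.mul_assoc, val_mul_self, ← val_star, h2.2]
      exact h3.trans (congrArg ι.val (by simp))

variable [IsStrongProjectionAlgebra P]

/-- This makes the connecting edge of `•` evaluate to the plain product ι(p)ι(q). -/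
theorem val_times_mul_star (p q : P) :
    ι.val (p ×ₚ q) * ι.val (p ⋆ₚ q) = ι.val p * ι.val q := by
  rw [← times_star, val_mul_star, val_times_mul]

theorem val_mul_of_le {p q : P} (h : le q p) : ι.val q * ι.val p = ι.val q := by
  have h2 := ast_mul_proj (ι.toFun p) (ι.val q)
  have h3 : ast (ι.val q * (ι.toFun p).1) = ι.val q := by
    rw [show (ι.toFun p).1 = ι.val p from rfl, ← val_star, h.star_eq]
  rwa [h3] at h2

/-- For an admissible triple, ι(e ⋆ p) after ι(e) may be replaced by ι(p), and so may ι(p × f)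
before ι(f). -/
theorem evalIn_eq_of_chainRel {a b : PPath P} (h : ChainRel a b) :
    a.evalIn ι.val = b.evalIn ι.val := by
  induction h with
  | idem p h => exact val_mul_self ι p
  | adm e p f h =>
    show ι.val e * (ι.val (e ⋆ₚ p) * ι.val f) = ι.val e * (ι.val (p ×ₚ f) * ι.val f)
    rw [val_times_mul, ← IsDRCSemigroup.mul_assoc, val_mul_star, IsDRCSemigroup.mul_assoc]
  | refl a => rfl
  | symm _ ih => exact ih.symm
  | trans _ _ ih ih' => exact ih.trans ih'
  | comp_left u _ _ _ ih => rw [evalIn_comp, evalIn_comp, ih]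
  | comp_right v _ _ _ ih => rw [evalIn_comp, evalIn_comp, ih]

/-- ι(q) absorbs ι(p), and ι(q)ι(x) = ι(q)ι(q ⋆ x) moves the restriction on to the next vertex. -/
theorem val_mul_listEval_of_le (t : List P) (p q : P) (hc : (p :: t).IsChain F) (h : le q p) :
    ι.val q * listEval ι.val t p = listEval ι.val (t.scanl (· ⋆ₚ ·) q).tail q := by
  induction t generalizing p q with
  | nil => exact val_mul_of_le ι h
  | cons x t ih =>
    rw [List.isChain_cons_cons] at hc
    obtain ⟨s, hs⟩ := PPath.scanl_head (q ⋆ₚ x) t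
    have h1 := ih x (q ⋆ₚ x) hc.2 (star_le _ _)
    rw [hs, List.tail_cons] at h1
    rw [List.scanl_cons, List.tail_cons, hs, listEval, listEval, ← h1,
      ← IsDRCSemigroup.mul_assoc, ← IsDRCSemigroup.mul_assoc, val_mul_of_le ι h,
      val_mul_star, IsDRCSemigroup.mul_assoc, val_mul_listEval]

theorem val_mul_evalIn (q : P) (a : PPath P) (h : le q a.dom) :
    ι.val q * a.evalIn ι.val = (PPath.leftRes q a h).evalIn ι.val := by
  obtain ⟨l, hl, hc⟩ := a
  cases l with
  | nil => exact absurd rfl hl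
  | cons p t =>
    rw [PPath.evalIn, PPath.evalIn, PPath.dom_leftRes]
    exact val_mul_listEval_of_le ι t p q hc h

/-- Law `vi` with x the value of a and y = ι(d), d the domain of the right restriction, gives xι(q)
= ι(d)x, so the left-handed statement applies. -/
theorem evalIn_mul_val (a : PPath P) (q : P) (h : le q a.ran) :
    a.evalIn ι.val * ι.val q = (PPath.rightRes a q h).evalIn ι.val := by
  have hd := PPath.dom_rightRes_le a q h
  have h1 := val_mul_evalIn ι _ a hd
  rw [← PPath.rightRes_eq_leftRes] at h1
  have h2 := IsDRCRestrictionSemigroup.vi (a.evalIn ι.val) (ι.val (PPath.rightRes a q h).dom)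
  rw [h1, ast_evalIn, PPath.ran_rightRes, plus_evalIn, val_mul_of_le ι hd, ast_val] at h2
  rw [h2, h1]

/-- The evaluation `[p₁, …, p_k] ↦ ι(p₁) ⋯ ι(p_k)` of the chain semigroup in `S`. -/
def eval (a : ChainSemigroup P) : S :=
  Quotient.lift (PPath.evalIn ι.val) (fun _ _ h => evalIn_eq_of_chainRel ι h) a

theorem eval_comp (a b : ChainCategory P) (h : a.ran = b.dom) :
    ι.eval (ChainCategory.comp a b h) = ι.eval a * ι.eval b := by
  obtain ⟨x, rfl⟩ := ChainCategory.exists_rep a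
  obtain ⟨y, rfl⟩ := ChainCategory.exists_rep b
  exact evalIn_comp ι x y h

theorem eval_leftRes (q : P) (a : ChainCategory P) (h : le q a.dom) :
    ι.eval (ChainCategory.leftRes q a h) = ι.val q * ι.eval a := by
  obtain ⟨x, rfl⟩ := ChainCategory.exists_rep a
  rw [ChainCategory.leftRes_mk]
  exact (val_mul_evalIn ι q x h).symm

theorem eval_rightRes (a : ChainCategory P) (q : P) (h : le q a.ran) :
    ι.eval (ChainCategory.rightRes a q h) = ι.eval a * ι.val q := by
  obtain ⟨x, rfl⟩ := ChainCategory.exists_rep a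
  rw [ChainCategory.rightRes_mk]
  exact (evalIn_mul_val ι x q h).symm

theorem plus_eval (a : ChainCategory P) : plus (ι.eval a) = ι.val a.dom := by
  obtain ⟨x, rfl⟩ := ChainCategory.exists_rep a
  exact plus_evalIn ι x

theorem ast_eval (a : ChainCategory P) : ast (ι.eval a) = ι.val a.ran := by
  obtain ⟨x, rfl⟩ := ChainCategory.exists_rep a
  exact ast_evalIn ι x

theorem eval_mul (a b : ChainSemigroup P) : ι.eval (a * b) = ι.eval a * ι.eval b := by
  have ha : ι.eval a * ι.val (ChainCategory.ran a) = ι.eval a := by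
    rw [← ast_eval]
    exact i' _
  have hb : ι.val (ChainCategory.dom b) * ι.eval b = ι.eval b := by
    rw [← plus_eval]
    exact i _
  have hp := val_mul_self ι (ChainCategory.ran a ×ₚ ChainCategory.dom b)
  have hq := val_mul_self ι (ChainCategory.ran a ⋆ₚ ChainCategory.dom b)
  have hpq := val_times_mul_star ι (ChainCategory.ran a) (ChainCategory.dom b)
  have h1 : ι.eval (a * b) =
      (ι.eval a * ι.val (ChainCategory.ran a ×ₚ ChainCategory.dom b) *
        (ι.val (ChainCategory.ran a ×ₚ ChainCategory.dom b) *
          ι.val (ChainCategory.ran a ⋆ₚ ChainCategory.dom b))) *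
        (ι.val (ChainCategory.ran a ⋆ₚ ChainCategory.dom b) * ι.eval b) := by
    rw [← eval_leftRes _ _ _ (star_le _ _), ← eval_rightRes _ _ _ (times_le _ _)]
    exact (eval_comp ι _ _ ((ChainCategory.ran_comp _ _ _).trans
      (ChainCategory.dom_leftRes _ _ _).symm)).trans (congrArg (· * _) (eval_comp ι _ _ _))
  -- The repeated connecting vertices cancel by idempotence; then ι(ran a) is absorbed by the value
  -- of a and ι(dom b) by that of b.
  rw [h1]
  simp only [IsDRCSemigroup.mul_assoc]
  rw [← IsDRCSemigroup.mul_assoc (ι.val (_ ×ₚ _)), hp, ← IsDRCSemigroup.mul_assoc (ι.val (_ ⋆ₚ _)),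
    hq, ← IsDRCSemigroup.mul_assoc (ι.val (_ ×ₚ _)), hpq, IsDRCSemigroup.mul_assoc, hb,
    ← IsDRCSemigroup.mul_assoc, ha]

theorem eval_isBiUnaryHom : IsBiUnaryHom (ι.eval : ChainSemigroup P → S) where
  map_mul := eval_mul ι
  map_plus a := (plus_eval ι a).symm
  map_ast a := (ast_eval ι a).symm

theorem eval_surjective (hS : IsProjectionGenerated S) :
    Function.Surjective (ι.eval : ChainSemigroup P → S) := by
  intro s
  have hs : s ∈ Subsemigroup.closure (projections S) := by
    rw [show Subsemigroup.closure (projections S) = ⊤ from hS]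
    exact Subsemigroup.mem_top s
  induction hs using Subsemigroup.closure_induction with
  | mem x hx =>
    obtain ⟨p, hp⟩ := ι.surjective ⟨x, hx⟩
    exact ⟨ChainCategory.obj p, congrArg Subtype.val hp⟩
  | mul x y _ _ ihx ihy =>
    obtain ⟨a, rfl⟩ := ihx
    obtain ⟨b, rfl⟩ := ihy
    exact ⟨a * b, eval_mul ι a b⟩

end ProjIso

end Universal

theorem theorem7p10 (P : Type u) [ProjOps P] [IsStrongProjectionAlgebra P] :
    (∃ _ : IsDRCRestrictionSemigroup (ChainSemigroup P),
      IsProjectionGenerated (ChainSemigroup P) ∧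
      projections (ChainSemigroup P) = Set.range (ChainCategory.obj : P → ChainSemigroup P) ∧
      ∃ ι : ProjIso P (projections (ChainSemigroup P)),
        ∀ p : P, (ι.toFun p : ChainSemigroup P) = ChainCategory.obj p) ∧
    ∀ (S : Type v) [BiUnary S] [IsDRCRestrictionSemigroup S], IsProjectionGenerated S →
      ∀ ι : ProjIso P (projections S),
        ∃ φ : ChainSemigroup P → S,
          IsBiUnaryHom φ ∧ Function.Surjective φ ∧
            ∀ p : P, φ (ChainCategory.obj p) = (ι.toFun p : S) := by
  refine ⟨⟨inferInstance, ChainCategory.isProjectionGenerated,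
    ChainCategory.projections_eq_range_obj, ChainCategory.projIso, fun _ => rfl⟩, ?_⟩
  intro S _ _ hS ι
  exact ⟨ι.eval, ι.eval_isBiUnaryHom, ι.eval_surjective hS, fun _ => rfl⟩
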